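/- Fix $d\ge 1$ and a smooth function $\chi:\mathbb R^d\to[0,1]$ supported in the open ball $B(0,4/3)$ with $\chi\equiv1$ on $\bar B(0,3/4)$. Set $\varphi(\xi)=\chi(\xi/2)-\chi(\xi)$ and, for $j\in\mathbb Z$, $\dot S_j=\chi(2^{-j}D)$ and $\dot\Delta_j=\varphi(2^{-j}D)$ (Fourier multipliers, $D=-i\nabla$). For a tempered distribution $z$ on $\mathbb R^d$, a threshold $J\in\mathbb Z$, $s\in\mathbb R$ and $1\le q\le\infty$ put, with values in $[0,\infty]$, $$\|z\|_{\dot{\mathbb B}^s_{q,1}}=\sum_{j\in\mathbb Z}2^{js}\|\dot\Delta_jz\|_{L^q},\qquad \|z\|^{\ell}_{\dot{\mathbb B}^s_{q,1}}=\sum_{j\le J+1}2^{js}\|\dot\Delta_jz\|_{L^q},\qquad \|z\|^{h}_{\dot{\mathbb B}^s_{q,1}}=\sum_{j\ge J}2^{js}\|\dot\Delta_jz\|_{L^q},$$ and let $\dot{\mathbb B}^s_{q,1}$ be the set of tempered distributions $z$ with $\lim_{j\to-\infty}\|\dot S_jz\|_{L^\infty}=0$ and $\|z\|_{\dot{\mathbb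 B}^s_{q,1}}<\infty$. Let $2\le p\le4$, $p^*=2p/(p-2)$ (so $p^*=\infty$ and $d/p^*=0$ if $p=2$) and $\sigma\ge s>0$. Then there is a constant $C$, depending only on $d,\chi,J,p,s,\sigma$, such that all $a,b\in\dot{\mathbb B}^{d/p}_{p,1}$ are bounded functions, and their pointwise product satisfies $$\|ab\|^h_{\dot{\mathbb B}^{s}_{2,1}}\le C\Bigl(\|a\|_{\dot{\mathbb B}^{d/p}_{p,1}}\|b\|^h_{\dot{\mathbb B}^{s}_{2,1}}+\|b\|_{\dot{\mathbb B}^{d/p}_{p,1}}\|a\|^h_{\dot{\mathbb B}^{s}_{2,1}}+\|a\|^\ell_{\dot{\mathbb B}^{d/p-d/p^*}_{p,1}}\|b\|^\ell_{\dot{\mathbb B}^{\sigma}_{p,1}}+\|b\|^\ell_{\dot{\mathbb B}^{d/p-d/p^*}_{p,1}}\|a\|^\ell_{\dot{\mathbb B}^{\sigma}_{p,1}}\Bigr)$$ (an inequality in $[0,\infty]$ with $0\cdot\infty=0$). -/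

import Mathlib

open MeasureTheory Filter Topology
open scoped SchwartzMap ENNReal NNReal ContDiff

noncomputable section

namespace HybridBesov

/-- The cut-off functions `χ` on which Littlewood-Paley decompositions are built: smooth, with
values in `[0,1]`, supported in the open ball `B(0,4/3)`, equal to `1` on the closed ball
of radius `3/4`. -/
structure IsCutoff {d : ℕ} (χ : EuclideanSpace ℝ (Fin d) → ℝ) : Prop where
  smooth : ContDiff ℝ ∞ χ
  range_mem : ∀ ξ, χ ξ ∈ Set.Icc (0 : ℝ) 1
  tsupport_subset : tsupport χ ⊆ Metric.ball 0 (4 / 3)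
  eq_one : ∀ ξ ∈ Metric.closedBall (0 : EuclideanSpace ℝ (Fin d)) (3 / 4), χ ξ = 1

variable {d : ℕ}

/-- The Fourier multiplier `m(2^{-j} D)`, `D = -i∇`. Mathlib's Fourier transform has the kernel
`exp(-2πi⟨x, ξ⟩)`, so that `D` has the symbol `2πξ`. -/
def dyadicMultiplier (m : EuclideanSpace ℝ (Fin d) → ℝ) (j : ℤ)
    (z : 𝓢'(EuclideanSpace ℝ (Fin d), ℂ)) : 𝓢'(EuclideanSpace ℝ (Fin d), ℂ) :=
  TemperedDistribution.fourierMultiplierCLM ℂ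
    (fun ξ => ((m (((2 : ℝ) ^ (-j) * (2 * Real.pi)) • ξ) : ℝ) : ℂ)) z

/-- The low frequency cut-off `Ṡ_j = χ(2^{-j} D)`. -/
def lowCut (χ : EuclideanSpace ℝ (Fin d) → ℝ) (j : ℤ)
    (z : 𝓢'(EuclideanSpace ℝ (Fin d), ℂ)) : 𝓢'(EuclideanSpace ℝ (Fin d), ℂ) :=
  dyadicMultiplier χ j z

/-- The dyadic block `Δ̇_j = φ(2^{-j} D)`, where `φ(ξ) = χ(ξ/2) - χ(ξ)`. -/
def block (χ : EuclideanSpace ℝ (Fin d) → ℝ) (j : ℤ)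
    (z : 𝓢'(EuclideanSpace ℝ (Fin d), ℂ)) : 𝓢'(EuclideanSpace ℝ (Fin d), ℂ) :=
  dyadicMultiplier (fun ξ => χ ((1 / 2 : ℝ) • ξ) - χ ξ) j z

/-- The tempered distribution `z` is the function `f ∈ L^q(ℝ^d)`. -/
def IsLpFunction (q : ℝ≥0∞) (z : 𝓢'(EuclideanSpace ℝ (Fin d), ℂ))
    (f : EuclideanSpace ℝ (Fin d) → ℂ) : Prop :=
  MemLp f q volume ∧ ∀ θ : 𝓢(EuclideanSpace ℝ (Fin d), ℂ), z θ = ∫ x, θ x * f x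

/-- The `L^q(ℝ^d)` norm of a tempered distribution, with value `∞` if the distribution is not
an `L^q` function (a representing function is unique almost everywhere). -/
def lpNorm (q : ℝ≥0∞) (z : 𝓢'(EuclideanSpace ℝ (Fin d), ℂ)) : ℝ≥0∞ :=
  ⨅ (f : EuclideanSpace ℝ (Fin d) → ℂ) (_ : IsLpFunction q z f), eLpNorm f q volume

/-- The space `𝓢'_h`: tempered distributions with `‖Ṡ_j z‖_{L^∞} → 0` as `j → -∞`. -/
def MemSh (χ : EuclideanSpace ℝ (Fin d) → ℝ) (z : 𝓢'(EuclideanSpace ℝ (Fin d), ℂ)) : Prop :=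
  Tendsto (fun j : ℤ => lpNorm ⊤ (lowCut χ j z)) atBot (𝓝 0)

/-- The weighted block norm `2^{js} ‖Δ̇_j z‖_{L^q}`. -/
def blockNorm (χ : EuclideanSpace ℝ (Fin d) → ℝ) (s : ℝ) (q : ℝ≥0∞)
    (z : 𝓢'(EuclideanSpace ℝ (Fin d), ℂ)) (j : ℤ) : ℝ≥0∞ :=
  ENNReal.ofReal ((2 : ℝ) ^ ((j : ℝ) * s)) * lpNorm q (block χ j z)

/-- The homogeneous Besov semi-norm of `Ḃ^s_{q,1}`. -/
def besovNorm (χ : EuclideanSpace ℝ (Fin d) → ℝ) (s : ℝ) (q : ℝ≥0∞)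
    (z : 𝓢'(EuclideanSpace ℝ (Fin d), ℂ)) : ℝ≥0∞ :=
  ∑' j : ℤ, blockNorm χ s q z j

/-- The low frequency semi-norm `‖z‖^{ℓ,J}` of `Ḃ^s_{q,1}`: blocks with `j ≤ J + 1`. -/
def besovNormLow (χ : EuclideanSpace ℝ (Fin d) → ℝ) (J : ℤ) (s : ℝ) (q : ℝ≥0∞)
    (z : 𝓢'(EuclideanSpace ℝ (Fin d), ℂ)) : ℝ≥0∞ :=
  ∑' j : Set.Iic (J + 1), blockNorm χ s q z j

/-- The high frequency semi-norm `‖z‖^{h,J}` of `Ḃ^s_{q,1}`: blocks with `j ≥ J`. -/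
def besovNormHigh (χ : EuclideanSpace ℝ (Fin d) → ℝ) (J : ℤ) (s : ℝ) (q : ℝ≥0∞)
    (z : 𝓢'(EuclideanSpace ℝ (Fin d), ℂ)) : ℝ≥0∞ :=
  ∑' j : Set.Ici J, blockNorm χ s q z j

/-- The homogeneous Besov space `Ḃ^s_{q,1}`. -/
def MemBesov (χ : EuclideanSpace ℝ (Fin d) → ℝ) (s : ℝ) (q : ℝ≥0∞)
    (z : 𝓢'(EuclideanSpace ℝ (Fin d), ℂ)) : Prop :=
  MemSh χ z ∧ besovNorm χ s q z < ⊤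

/-- `c` is the product `ab`: the distributions `a` and `b` are bounded functions and `c` is their
pointwise product. -/
def IsProduct (a b c : 𝓢'(EuclideanSpace ℝ (Fin d), ℂ)) : Prop :=
  ∃ f g : EuclideanSpace ℝ (Fin d) → ℂ,
    IsLpFunction ⊤ a f ∧ IsLpFunction ⊤ b g ∧ IsLpFunction ⊤ c (fun x => f x * g x)

/-- The exponent `p* = 2p/(p-2)`, which is `∞` for `p = 2`. -/
def pStar (p : ℝ) : ℝ≥0∞ := ENNReal.ofReal (2 * p) / ENNReal.ofReal (p - 2)

end HybridBesov

end

noncomputable section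

open scoped FourierTransform

namespace HybridBesov

variable {d : ℕ}

local notation "𝔼" => EuclideanSpace ℝ (Fin d)

/-! ### Representing functions -/

/-! By Bernstein, `‖Δ̇_i z‖_∞ ≤ C 2^{id/p} ‖Δ̇_i z‖_p`, so the blocks of `a` and `b` form normally
convergent series (`exists_isNormalSeries`). The condition `Ṡ_j z → 0` at `-∞` excludes a remainder,
so `a` and `b` are the sums of these series and `Ṡ_k a`, `Ṡ_k b` their partial sums
(`isLpFunction_lowCut`, `isLpFunction_fullSum`).

No paraproduct is needed: `ab = lim Ṡ_k a Ṡ_k b`, and the step from `k` to `k + 1` adds `Ṡ_{k+1} a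
Δ̇_k b + Δ̇_k a Ṡ_k b`. The spectrum of `Ṡ_{j-3} a Ṡ_{j-3} b` is too low to meet `Δ̇_j`, so only the
increments with `k ≥ j - 3` reach `Δ̇_j(ab)`; moreover `Δ̇_j` is a contraction of `L²`
(`lpNorm_block_product_le`). Since `s > 0`, the weights `2^{js}` sum geometrically over `j ≤ k + 3`,
which leaves `∑_{k ≥ J-3} 2^{ks} ‖increment_k‖_2`.

For `k ≥ J`, the Hölder pair `L^∞ × L²` gives the first two terms of the bound. The three indices `J
- 3 ≤ k < J` lie outside the high frequency norms and use `L^{p*} × L^p`: the partial sum contains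
only blocks of index below `J`, Bernstein from `L^p` to `L^{p*}` costs `2^{i(d/p - d/p*)}`, and
`2^{ks}` is comparable to `2^{kσ}`. This gives the last two terms. -/

theorem IsLpFunction.integrable {q : ℝ≥0∞} (hq : 1 ≤ q) {z : 𝓢'(𝔼, ℂ)} {f : 𝔼 → ℂ}
    (hf : IsLpFunction q z f) (θ : 𝓢(𝔼, ℂ)) : Integrable (fun x => θ x * f x) := by
  have h : ENNReal.HolderConjugate q (1 - q⁻¹)⁻¹ := ENNReal.HolderConjugate.inv_one_sub_inv' hq
  have h' := h.symm
  exact (θ.memLp (1 - q⁻¹)⁻¹).integrable_mul hf.1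

/-- Test functions separate locally integrable functions. The exponents may differ, so the bounded
representative of a block also computes its `L²` and `L^p` norms. -/
theorem IsLpFunction.ae_eq {q r : ℝ≥0∞} (hq : 1 ≤ q) (hr : 1 ≤ r) {z : 𝓢'(𝔼, ℂ)} {f g : 𝔼 → ℂ}
    (hf : IsLpFunction q z f) (hg : IsLpFunction r z g) : f =ᵐ[volume] g := by
  refine ae_eq_of_integral_contDiff_smul_eq (hf.1.locallyIntegrable hq)
    (hg.1.locallyIntegrable hr) fun u u_smooth u_cpt => ?_
  have h₁ : HasCompactSupport (Complex.ofRealCLM ∘ u) := u_cpt.comp_left rfl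
  have h₂ : ContDiff ℝ ∞ (Complex.ofRealCLM ∘ u) := by fun_prop
  have h := (hf.2 (h₁.toSchwartzMap h₂)).symm.trans (hg.2 (h₁.toSchwartzMap h₂))
  simpa using h

theorem eLpNorm_le_lpNorm {q r : ℝ≥0∞} (hq : 1 ≤ q) (hr : 1 ≤ r) {z : 𝓢'(𝔼, ℂ)} {f : 𝔼 → ℂ}
    (hf : IsLpFunction q z f) : eLpNorm f r ≤ lpNorm r z :=
  le_iInf₂ fun _ hg => (eLpNorm_congr_ae (hf.ae_eq hq hr hg)).le

theorem IsLpFunction.lpNorm_le {q : ℝ≥0∞} {z : 𝓢'(𝔼, ℂ)} {f : 𝔼 → ℂ}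
    (hf : IsLpFunction q z f) : lpNorm q z ≤ eLpNorm f q :=
  iInf₂_le f hf

theorem exists_isLpFunction_of_lpNorm_lt_top {q : ℝ≥0∞} {z : 𝓢'(𝔼, ℂ)} (hz : lpNorm q z < ⊤) :
    ∃ f, IsLpFunction q z f := by
  by_contra! h
  simp [lpNorm, h] at hz

theorem norm_apply_le_lpNorm_top {z : 𝓢'(𝔼, ℂ)} (hz : lpNorm ⊤ z < ⊤) (θ : 𝓢(𝔼, ℂ)) :
    ‖z θ‖ ≤ (lpNorm ⊤ z).toReal * ∫ x, ‖θ x‖ := by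
  obtain ⟨f, hf⟩ := exists_isLpFunction_of_lpNorm_lt_top hz
  have hb : ∀ᵐ x, ‖f x‖ ≤ (lpNorm ⊤ z).toReal := by
    have h1 : eLpNorm f ⊤ ≤ lpNorm ⊤ z := eLpNorm_le_lpNorm le_top le_top hf
    filter_upwards [ae_le_eLpNormEssSup (f := f) (μ := volume)] with x hx
    rw [← eLpNorm_exponent_top] at hx
    have := ENNReal.toReal_mono hz.ne (hx.trans h1)
    simpa using this
  rw [hf.2, ← integral_const_mul]
  refine norm_integral_le_of_norm_le (θ.integrable.norm.const_mul _) ?_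
  filter_upwards [hb] with x hx
  rw [norm_mul, mul_comm]
  gcongr

theorem exists_isLpFunction {q : ℝ≥0∞} (hq : 1 ≤ q) {f : 𝔼 → ℂ} (hf : MemLp f q) :
    ∃ z, IsLpFunction q z f := by
  have : Fact (1 ≤ q) := ⟨hq⟩
  refine ⟨Lp.toTemperedDistribution (hf.toLp f), hf, fun θ => ?_⟩
  rw [Lp.toTemperedDistribution_apply]
  refine integral_congr_ae ?_
  filter_upwards [hf.coeFn_toLp] with x hx
  rw [hx, smul_eq_mul]

/-- A tempered distribution that is bounded for the `L²` norm is an `L²` function. -/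
theorem lpNorm_two_le {z : 𝓢'(𝔼, ℂ)} {M : ℝ≥0}
    (h : ∀ θ : 𝓢(𝔼, ℂ), ‖z θ‖ ≤ M * ‖θ.toLp 2‖) : lpNorm 2 z ≤ M := by
  -- Extension by density to `L²`, then Riesz representation. The inner product is conjugate linear
  -- in its first slot, so the representing function is the conjugate of the Riesz vector.
  have hd : DenseRange (SchwartzMap.toLpCLM ℂ ℂ 2 (volume : Measure 𝔼)) :=
    SchwartzMap.denseRange_toLpCLM (by simp)
  let zl : 𝓢(𝔼, ℂ) →ₗ[ℂ] ℂ := z.toLinearMap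
  let T : 𝓢(𝔼, ℂ) →ₗ[ℂ] Lp ℂ 2 (volume : Measure 𝔼) :=
    (SchwartzMap.toLpCLM ℂ ℂ 2 (volume : Measure 𝔼)).toLinearMap
  let Φ : Lp ℂ 2 (volume : Measure 𝔼) →L[ℂ] ℂ := zl.extendOfNorm T
  have hΦ : ∀ θ, Φ (T θ) = z θ := fun θ => LinearMap.extendOfNorm_eq hd ⟨M, h⟩ θ
  have hΦn : ‖Φ‖ ≤ M := LinearMap.opNorm_extendOfNorm_le hd M.2 h
  let v := (InnerProductSpace.toDual ℂ _).symm Φ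
  have hv : ‖v‖ ≤ M := by simpa [v] using hΦn
  have hvm : MemLp (fun x => starRingEnd ℂ (v x)) 2 volume := (Lp.memLp v).star
  have hr : IsLpFunction 2 z (fun x => starRingEnd ℂ (v x)) := by
    refine ⟨hvm, fun θ => ?_⟩
    rw [← hΦ θ, ← InnerProductSpace.toDual_symm_apply (𝕜 := ℂ) (y := Φ), L2.inner_def]
    refine integral_congr_ae ?_
    filter_upwards [θ.coeFn_toLp 2 volume] with x hx
    have : (T θ : 𝔼 → ℂ) x = θ x := hx
    rw [this]
    simp [v]
  refine hr.lpNorm_le.trans ?_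
  have : eLpNorm (fun x => starRingEnd ℂ (v x)) 2 volume = eLpNorm v 2 volume :=
    eLpNorm_congr_norm_ae (by simp)
  rw [this, ← Lp.enorm_def]
  exact_mod_cast hv

/-! ### Fourier multipliers with Schwartz symbols as convolutions -/

/-- The Fourier transform is moved from `u` to `g` times a character, and modulation of `g` becomes
translation of its transform. Only integrability of `u` is needed. -/
theorem fourier_mul_fourierInv (g : 𝓢(𝔼, ℂ)) {u : 𝔼 → ℂ} (hu : Integrable u) (y : 𝔼) :
    𝓕 (fun ξ => g ξ * 𝓕⁻ u ξ) y = ∫ x, u x * 𝓕 (g : 𝔼 → ℂ) (y - x) := by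
  have key := VectorFourier.integral_fourierIntegral_smul_eq_flip (L := -innerₗ 𝔼)
    (μ := volume) (ν := volume) (f := u)
    (g := fun ξ => (Real.fourierChar (-inner ℝ ξ y) : ℂ) • g ξ) Real.continuous_fourierChar
    (continuous_inner (𝕜 := ℝ) (E := 𝔼)).neg hu
    (by simpa [Circle.smul_def] using (Real.fourierIntegral_convergent_iff y).2 g.integrable)
  have h1 : ∀ ξ, VectorFourier.fourierIntegral Real.fourierChar volume (-innerₗ 𝔼) u ξ
      = 𝓕⁻ u ξ := fun ξ => rfl
  have h2 : ∀ x, VectorFourier.fourierIntegral Real.fourierChar volume (-innerₗ 𝔼).flip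
      (fun ξ => (Real.fourierChar (-inner ℝ ξ y) : ℂ) • g ξ) x = 𝓕 (g : 𝔼 → ℂ) (y - x) := by
    intro x
    rw [Real.fourier_eq, VectorFourier.fourierIntegral]
    refine integral_congr_ae (ae_of_all _ fun ξ => ?_)
    simp only [Circle.smul_def, smul_smul, LinearMap.flip_apply, LinearMap.neg_apply,
      innerₗ_apply_apply, neg_neg, inner_sub_right, neg_sub]
    rw [← Circle.coe_mul, ← AddChar.map_add_eq_mul, real_inner_comm x ξ, sub_eq_add_neg]
  simp only [h1, h2] at key
  simp only [smul_eq_mul] at key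
  rw [← key, Real.fourier_eq]
  refine integral_congr_ae (ae_of_all _ fun ξ => ?_)
  simp only [Circle.smul_def, smul_eq_mul]
  ring

/-- The kernel integral `∫ K(y - x) f(y) dy`. -/
def kernelIntegral (K f : 𝔼 → ℂ) (x : 𝔼) : ℂ := ∫ y, K (y - x) * f y

theorem enorm_kernelIntegral_le {q q' : ℝ≥0∞} [q'.HolderConjugate q] {K f : 𝔼 → ℂ}
    (hK : AEStronglyMeasurable K) (hf : AEStronglyMeasurable f) (x : 𝔼) :
    ∫⁻ y, ‖K (y - x) * f y‖ₑ ≤ eLpNorm K q' * eLpNorm f q := by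
  have hmp := measurePreserving_sub_right (volume : Measure 𝔼) x
  have h := eLpNorm_smul_le_mul_eLpNorm (p := q') (q := q) (r := 1) hf
    (hK.comp_measurePreserving hmp)
  rw [eLpNorm_one_eq_lintegral_enorm, eLpNorm_comp_measurePreserving hK hmp] at h
  exact h

theorem aestronglyMeasurable_comp_snd_sub_fst {K : 𝔼 → ℂ} (hK : AEStronglyMeasurable K) :
    AEStronglyMeasurable (fun z : 𝔼 × 𝔼 => K (z.2 - z.1)) ((volume : Measure 𝔼).prod volume) := by
  have h1 := quasiMeasurePreserving_sub_of_right_invariant (volume : Measure 𝔼) volume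
  have h2 := h1.comp
    (Measure.measurePreserving_swap (μ := (volume : Measure 𝔼))
      (ν := (volume : Measure 𝔼))).quasiMeasurePreserving
  exact hK.comp_quasiMeasurePreserving h2

theorem integrable_kernel_prod {q q' : ℝ≥0∞} [q'.HolderConjugate q] {K f u : 𝔼 → ℂ}
    (hK : MemLp K q') (hf : MemLp f q) (hu : Integrable u) :
    Integrable (Function.uncurry fun x y : 𝔼 => u x * (K (y - x) * f y))
      ((volume : Measure 𝔼).prod volume) := by
  have hm : AEStronglyMeasurable (Function.uncurry fun x y : 𝔼 => u x * (K (y - x) * f y))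
      ((volume : Measure 𝔼).prod volume) :=
    hu.1.comp_fst.mul ((aestronglyMeasurable_comp_snd_sub_fst hK.1).mul hf.1.comp_snd)
  set M := eLpNorm K q' * eLpNorm f q
  have hMt : M < ⊤ := ENNReal.mul_lt_top hK.2 hf.2
  have hx : ∀ x, ∫⁻ y, ‖u x * (K (y - x) * f y)‖ₑ ≤ ‖u x‖ₑ * M := fun x => by
    simp_rw [enorm_mul (u x)]
    rw [lintegral_const_mul' _ _ enorm_ne_top]
    exact mul_le_mul_right (enorm_kernelIntegral_le hK.1 hf.1 x) _
  refine ⟨hm, ?_⟩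
  rw [hasFiniteIntegral_iff_enorm, lintegral_prod _ hm.enorm]
  refine (lintegral_mono hx).trans_lt ?_
  rw [lintegral_mul_const' _ _ hMt.ne]
  exact ENNReal.mul_lt_top (hasFiniteIntegral_iff_enorm.1 hu.2) hMt

theorem integral_mul_kernelIntegral {q q' : ℝ≥0∞} [q'.HolderConjugate q] {K f u : 𝔼 → ℂ}
    (hK : MemLp K q') (hf : MemLp f q) (hu : Integrable u) :
    ∫ x, u x * kernelIntegral K f x = ∫ y, (∫ x, u x * K (y - x)) * f y := by
  have h := integral_integral_swap (integrable_kernel_prod hK hf hu)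
  simp only [kernelIntegral, ← integral_const_mul, ← integral_mul_const]
  refine h.trans ?_
  simp only [mul_assoc]

theorem aestronglyMeasurable_kernelIntegral {q q' : ℝ≥0∞} [q'.HolderConjugate q] {K f : 𝔼 → ℂ}
    (hK : MemLp K q') (hf : MemLp f q) : AEStronglyMeasurable (kernelIntegral K f) := by
  have hm : AEStronglyMeasurable (fun z : 𝔼 × 𝔼 => K (z.2 - z.1) * f z.2)
      ((volume : Measure 𝔼).prod volume) :=
    (aestronglyMeasurable_comp_snd_sub_fst hK.1).mul hf.1.comp_snd
  have h := hm.integral_prod_right'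
  exact h

/-- A Fourier multiplier with Schwartz symbol maps an `L^q` function to the bounded function given
by convolution with the kernel. -/
theorem IsLpFunction.multiplier {q : ℝ≥0∞} (hq : 1 ≤ q) {z : 𝓢'(𝔼, ℂ)} {f : 𝔼 → ℂ}
    (hf : IsLpFunction q z f) (g : 𝓢(𝔼, ℂ)) :
    IsLpFunction ⊤ (TemperedDistribution.fourierMultiplierCLM ℂ g z)
      (kernelIntegral (𝓕 g : 𝓢(𝔼, ℂ)) f) := by
  have hc : ENNReal.HolderConjugate (1 - q⁻¹)⁻¹ q :=
    (ENNReal.HolderConjugate.inv_one_sub_inv' hq).symm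
  have hK : MemLp (𝓕 g : 𝓢(𝔼, ℂ)) (1 - q⁻¹)⁻¹ := (𝓕 g : 𝓢(𝔼, ℂ)).memLp _
  refine ⟨⟨aestronglyMeasurable_kernelIntegral hK hf.1, ?_⟩, fun θ => ?_⟩
  · refine (eLpNorm_le_of_ae_enorm_bound (C := eLpNorm (𝓕 g : 𝓢(𝔼, ℂ)) (1 - q⁻¹)⁻¹ * eLpNorm f q)
      (ae_of_all _ fun x => ?_)).trans_lt ?_
    · exact (enorm_integral_le_lintegral_enorm _).trans (enorm_kernelIntegral_le hK.1 hf.1.1 x)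
    · simpa using ENNReal.mul_lt_top hK.2 hf.1.2
  · rw [integral_mul_kernelIntegral hK hf.1 θ.integrable,
      TemperedDistribution.fourierMultiplierCLM_apply_apply, hf.2]
    refine integral_congr_ae (ae_of_all _ fun y => ?_)
    simp only
    congr 1
    rw [SchwartzMap.fourier_coe g, ← fourier_mul_fourierInv g θ.integrable y,
      SchwartzMap.fourier_coe]
    refine congrArg (fun v : 𝔼 → ℂ => 𝓕 v y) (funext fun ξ => ?_)
    rw [SchwartzMap.smulLeftCLM_apply_apply g.hasTemperateGrowth, smul_eq_mul,
      SchwartzMap.fourierInv_coe]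

/-- A bounded function whose spectrum lies in `{g ≠ 0}` integrates to zero against an integrable
function whose inverse Fourier transform vanishes there. -/
theorem integral_mul_eq_zero_of_multiplier_eq {z : 𝓢'(𝔼, ℂ)} {f u : 𝔼 → ℂ}
    (hf : IsLpFunction ⊤ z f) (g : 𝓢(𝔼, ℂ))
    (hg : TemperedDistribution.fourierMultiplierCLM ℂ g z = z) (hu : Integrable u)
    (h : ∀ ξ, g ξ * 𝓕⁻ u ξ = 0) : ∫ x, u x * f x = 0 := by
  have hm := hf.multiplier le_top g
  rw [hg] at hm
  have hae := hf.ae_eq le_top le_top hm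
  have hK : MemLp (𝓕 g : 𝓢(𝔼, ℂ)) 1 := (𝓕 g : 𝓢(𝔼, ℂ)).memLp _
  -- The function `f` equals its own convolution; after Fubini the inner integral is the Fourier
  -- transform of `g · 𝓕⁻ u = 0`.
  calc ∫ x, u x * f x = ∫ x, u x * kernelIntegral (𝓕 g : 𝓢(𝔼, ℂ)) f x := by
        refine integral_congr_ae ?_
        filter_upwards [hae] with x hx
        rw [hx]
    _ = ∫ y, (∫ x, u x * (𝓕 g : 𝓢(𝔼, ℂ)) (y - x)) * f y :=
        integral_mul_kernelIntegral hK hf.1 hu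
    _ = 0 := by
        rw [SchwartzMap.fourier_coe g]
        simp only [← fourier_mul_fourierInv g hu, h]
        simp [Real.fourier_eq]

/-! ### Fourier transforms and Lebesgue norms under dilation. -/

theorem fourier_comp_smul (g : 𝔼 → ℂ) {r : ℝ} (hr : 0 < r) (x : 𝔼) :
    𝓕 (fun ξ => g (r • ξ)) x = ((r ^ d)⁻¹ : ℝ) • 𝓕 g (r⁻¹ • x) := by
  rw [Real.fourier_eq, Real.fourier_eq]
  have h := Measure.integral_comp_smul_of_nonneg (volume : Measure 𝔼)
    (fun ξ => Real.fourierChar (-inner ℝ ξ (r⁻¹ • x)) • g ξ) r (hR := hr.le)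
  rw [finrank_euclideanSpace_fin] at h
  rw [← h]
  refine integral_congr_ae (ae_of_all _ fun ξ => ?_)
  simp only [inner_smul_left, inner_smul_right]
  congr 4
  simp [hr.ne']

theorem eLpNorm_comp_inv_smul {q : ℝ≥0∞} (hq : q ≠ ⊤) (K : 𝔼 → ℂ) {r : ℝ} (hr : 0 < r) :
    eLpNorm (fun x => K (r⁻¹ • x)) q volume
      = ENNReal.ofReal (r ^ (d / q.toReal)) * eLpNorm K q := by
  have he : MeasurableEmbedding (fun x : 𝔼 => r⁻¹ • x) :=
    (Homeomorph.smulOfNeZero r⁻¹ (inv_ne_zero hr.ne')).measurableEmbedding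
  have h := he.eLpNorm_map_measure (p := q) (μ := volume) (g := K)
  rw [Function.comp_def] at h
  rw [← h, Measure.map_addHaar_smul _ (inv_ne_zero hr.ne'), finrank_euclideanSpace_fin,
    eLpNorm_smul_measure_of_ne_top hq, smul_eq_mul, inv_pow, inv_inv, abs_of_nonneg (by positivity),
    ENNReal.ofReal_rpow_of_nonneg (by positivity) (by positivity), ← Real.rpow_natCast,
    ← Real.rpow_mul hr.le, ENNReal.toReal_div]
  simp [div_eq_mul_inv]

/-- The change of variables gives `r^{-d}` and the dilated norm `r^{d/q'}`; since `1/q' = 1 - 1/q`,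
the product is `r^{-d/q}`. This is the power of `2^i` in Bernstein's inequality. -/
theorem eLpNorm_fourier_comp_smul {q q' : ℝ≥0∞} [hc : q'.HolderConjugate q] (hq : q' ≠ ⊤)
    (g : 𝔼 → ℂ) {r : ℝ} (hr : 0 < r) :
    eLpNorm (𝓕 (fun ξ => g (r • ξ))) q' volume
      = ENNReal.ofReal (r ^ (-(d / q.toReal))) * eLpNorm (𝓕 g) q' := by
  have h1 : 𝓕 (fun ξ => g (r • ξ)) = ((r ^ d)⁻¹ : ℝ) • (fun x => 𝓕 g (r⁻¹ • x)) := by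
    ext x
    exact fourier_comp_smul g hr x
  rw [h1, eLpNorm_const_smul, eLpNorm_comp_inv_smul hq _ hr, ← mul_assoc,
    Real.enorm_of_nonneg (by positivity), ← ENNReal.ofReal_mul (by positivity)]
  congr 2
  have hq0 : q'⁻¹.toReal + q⁻¹.toReal = 1 := by
    rw [← ENNReal.toReal_add (by simpa using hc.ne_zero) (by simpa using hc.symm.ne_zero),
      hc.inv_add_inv_eq_one]
    simp
  rw [← Real.rpow_natCast, ← Real.rpow_neg hr.le, ← Real.rpow_add hr]
  congr 1
  rw [div_eq_mul_inv, div_eq_mul_inv, ← ENNReal.toReal_inv, ← ENNReal.toReal_inv]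
  linear_combination (d : ℝ) * hq0

/-! ### Dilated cut-offs -/

/-- The symbol of `χ(2^{-j} D)`. -/
def dilatedSymbol (χ : 𝔼 → ℝ) (j : ℤ) (ξ : 𝔼) : ℂ :=
  ((χ (((2 : ℝ) ^ (-j) * (2 * Real.pi)) • ξ) : ℝ) : ℂ)

theorem scale_pos (j : ℤ) : (0 : ℝ) < (2 : ℝ) ^ (-j) * (2 * Real.pi) := by positivity

theorem scale_succ (j : ℤ) :
    (2 : ℝ) ^ (-(j + 1)) * (2 * Real.pi) = 1 / 2 * ((2 : ℝ) ^ (-j) * (2 * Real.pi)) := by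
  rw [neg_add, zpow_add₀ two_ne_zero]
  norm_num
  ring

theorem norm_scale_smul (j : ℤ) (ξ : 𝔼) :
    ‖((2 : ℝ) ^ (-j) * (2 * Real.pi)) • ξ‖ = (2 : ℝ) ^ (-j) * (2 * Real.pi) * ‖ξ‖ := by
  rw [norm_smul, Real.norm_of_nonneg (scale_pos j).le]

theorem IsCutoff.eq_zero {χ : 𝔼 → ℝ} (hχ : IsCutoff χ) {ξ : 𝔼} (h : 4 / 3 ≤ ‖ξ‖) : χ ξ = 0 := by
  refine image_eq_zero_of_notMem_tsupport fun hm => ?_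
  have := hχ.tsupport_subset hm
  rw [mem_ball_zero_iff] at this
  linarith

theorem IsCutoff.hasCompactSupport {χ : 𝔼 → ℝ} (hχ : IsCutoff χ) : HasCompactSupport χ :=
  (isCompact_closedBall (0 : 𝔼) (4 / 3)).of_isClosed_subset (isClosed_tsupport χ)
    (hχ.tsupport_subset.trans Metric.ball_subset_closedBall)

/-- The cut-off as a complex valued Schwartz function. -/
def IsCutoff.toSchwartz {χ : 𝔼 → ℝ} (hχ : IsCutoff χ) : 𝓢(𝔼, ℂ) :=
  (hχ.hasCompactSupport.comp_left (g := Complex.ofRealCLM) (map_zero _)).toSchwartzMap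
    (Complex.ofRealCLM.contDiff.comp hχ.smooth)

theorem IsCutoff.toSchwartz_apply {χ : 𝔼 → ℝ} (hχ : IsCutoff χ) (ξ : 𝔼) :
    hχ.toSchwartz ξ = (χ ξ : ℂ) := rfl

/-- The dilated symbol as a Schwartz function. -/
def IsCutoff.symbol {χ : 𝔼 → ℝ} (hχ : IsCutoff χ) (j : ℤ) : 𝓢(𝔼, ℂ) :=
  SchwartzMap.compCLMOfContinuousLinearEquiv ℂ
    (ContinuousLinearEquiv.smulLeft (Units.mk0 _ (scale_pos j).ne')) hχ.toSchwartz

theorem IsCutoff.coe_symbol {χ : 𝔼 → ℝ} (hχ : IsCutoff χ) (j : ℤ) :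
    (hχ.symbol j : 𝔼 → ℂ) = dilatedSymbol χ j := rfl

theorem IsCutoff.hasTemperateGrowth {χ : 𝔼 → ℝ} (hχ : IsCutoff χ) (j : ℤ) :
    (dilatedSymbol χ j).HasTemperateGrowth :=
  hχ.coe_symbol j ▸ (hχ.symbol j).hasTemperateGrowth

theorem dilatedSymbol_eq_one {χ : 𝔼 → ℝ} (hχ : IsCutoff χ) {j : ℤ} {ξ : 𝔼}
    (h : (2 : ℝ) ^ (-j) * (2 * Real.pi) * ‖ξ‖ ≤ 3 / 4) : dilatedSymbol χ j ξ = 1 := by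
  rw [dilatedSymbol, hχ.eq_one _ (by rwa [mem_closedBall_zero_iff, norm_scale_smul]),
    Complex.ofReal_one]

theorem dilatedSymbol_eq_zero {χ : 𝔼 → ℝ} (hχ : IsCutoff χ) {j : ℤ} {ξ : 𝔼}
    (h : 4 / 3 ≤ (2 : ℝ) ^ (-j) * (2 * Real.pi) * ‖ξ‖) : dilatedSymbol χ j ξ = 0 := by
  rw [dilatedSymbol, hχ.eq_zero (by rwa [norm_scale_smul]), Complex.ofReal_zero]

/-- Halving the support radius `4/3` gives `2/3 ≤ 3/4`, inside the region where the cut-off is one.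
-/
theorem dilatedSymbol_mul_succ {χ : 𝔼 → ℝ} (hχ : IsCutoff χ) (j : ℤ) :
    dilatedSymbol χ j * dilatedSymbol χ (j + 1) = dilatedSymbol χ j := by
  ext ξ
  rw [Pi.mul_apply]
  rcases le_total (4 / 3) ((2 : ℝ) ^ (-j) * (2 * Real.pi) * ‖ξ‖) with h | h
  · rw [dilatedSymbol_eq_zero hχ h, zero_mul]
  · rw [dilatedSymbol_eq_one hχ (j := j + 1) (by rw [scale_succ]; linarith), mul_one]

theorem lowCut_eq (χ : 𝔼 → ℝ) (j : ℤ) (z : 𝓢'(𝔼, ℂ)) :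
    lowCut χ j z = TemperedDistribution.fourierMultiplierCLM ℂ (dilatedSymbol χ j) z := rfl

theorem block_eq_multiplier (χ : 𝔼 → ℝ) (j : ℤ) (z : 𝓢'(𝔼, ℂ)) :
    block χ j z = TemperedDistribution.fourierMultiplierCLM ℂ
      (dilatedSymbol χ (j + 1) - dilatedSymbol χ j) z := by
  rw [block, dyadicMultiplier]
  congr 2
  ext ξ
  simp only [Pi.sub_apply, dilatedSymbol, scale_succ, mul_smul, Complex.ofReal_sub]

theorem block_eq_sub {χ : 𝔼 → ℝ} (hχ : IsCutoff χ) (j : ℤ) (z : 𝓢'(𝔼, ℂ)) :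
    block χ j z = lowCut χ (j + 1) z - lowCut χ j z := by
  ext θ
  rw [block_eq_multiplier, TemperedDistribution.fourierMultiplierCLM_apply_apply,
    SchwartzMap.smulLeftCLM_sub (hχ.hasTemperateGrowth _) (hχ.hasTemperateGrowth _),
    sub_apply,
    ← FourierTransform.fourierCLM_apply (R := ℂ), map_sub, map_sub]
  rfl

theorem lowCut_succ_eq_add {χ : 𝔼 → ℝ} (hχ : IsCutoff χ) (j : ℤ) (z : 𝓢'(𝔼, ℂ)) :
    lowCut χ (j + 1) z = lowCut χ j z + block χ j z := by
  rw [block_eq_sub hχ, add_sub_cancel]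

theorem lowCut_succ_lowCut {χ : 𝔼 → ℝ} (hχ : IsCutoff χ) (j : ℤ) (z : 𝓢'(𝔼, ℂ)) :
    lowCut χ (j + 1) (lowCut χ j z) = lowCut χ j z := by
  rw [lowCut_eq, lowCut_eq, TemperedDistribution.fourierMultiplierCLM_fourierMultiplierCLM_apply
    (hχ.hasTemperateGrowth _) (hχ.hasTemperateGrowth _), dilatedSymbol_mul_succ hχ]

theorem dilatedSymbol_mul_add_two {χ : 𝔼 → ℝ} (hχ : IsCutoff χ) (j : ℤ) :
    dilatedSymbol χ j * dilatedSymbol χ (j + 2) = dilatedSymbol χ j := by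
  have h := dilatedSymbol_mul_succ hχ (j + 1)
  rw [add_assoc, one_add_one_eq_two] at h
  nth_rewrite 1 [← dilatedSymbol_mul_succ hχ j]
  rw [mul_assoc, h, dilatedSymbol_mul_succ hχ]

theorem lowCut_add_two_block {χ : 𝔼 → ℝ} (hχ : IsCutoff χ) (j : ℤ) (z : 𝓢'(𝔼, ℂ)) :
    lowCut χ (j + 2) (block χ j z) = block χ j z := by
  have h := dilatedSymbol_mul_succ hχ (j + 1)
  rw [add_assoc, one_add_one_eq_two] at h
  rw [lowCut_eq, block_eq_multiplier,
    TemperedDistribution.fourierMultiplierCLM_fourierMultiplierCLM_apply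
    ((hχ.hasTemperateGrowth _).sub (hχ.hasTemperateGrowth _)) (hχ.hasTemperateGrowth _),
    sub_mul, dilatedSymbol_mul_add_two hχ, h]

/-! ### Convergence of `Ṡ_j z` to `z` -/

theorem exists_norm_iteratedFDeriv_one_sub_le (X : 𝓢(𝔼, ℂ)) (i : ℕ) :
    ∃ M : ℝ, 0 ≤ M ∧ ∀ x, ‖iteratedFDeriv ℝ i (fun ξ => 1 - X ξ) x‖ ≤ M := by
  refine ⟨1 + SchwartzMap.seminorm ℝ 0 i X, by positivity, fun x => ?_⟩
  have h : iteratedFDeriv ℝ i (fun ξ => 1 - X ξ) x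
      = iteratedFDeriv ℝ i (fun _ => (1 : ℂ)) x - iteratedFDeriv ℝ i X x :=
    fun_iteratedFDeriv_sub_apply contDiffAt_const (X.contDiffAt i)
  rw [h]
  refine (norm_sub_le _ _).trans (add_le_add ?_ (X.norm_iteratedFDeriv_le_seminorm ℝ i x))
  rcases Nat.eq_zero_or_pos i with rfl | hi
  · simp
  · rw [iteratedFDeriv_const_of_ne hi.ne']
    simp

/-- Where `m(r·)` does not vanish, `1 ≤ (4/3) r ‖x‖`: one additional power of the weight buys the
factor `r`. Differentiating `m(r·)` costs nothing as `r ≤ 1`. -/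
theorem exists_pow_mul_norm_iteratedFDeriv_le {m : 𝔼 → ℂ} (hm : ContDiff ℝ ∞ m)
    (hm0 : ∀ ξ ∈ Metric.closedBall (0 : 𝔼) (3 / 4), m ξ = 0)
    (hmb : ∀ i, ∃ M : ℝ, 0 ≤ M ∧ ∀ x, ‖iteratedFDeriv ℝ i m x‖ ≤ M) (η : 𝓢(𝔼, ℂ)) (k n : ℕ) :
    ∃ C : ℝ, 0 ≤ C ∧ ∀ r : ℝ, 0 < r → r ≤ 1 → ∀ x,
      ‖x‖ ^ k * ‖iteratedFDeriv ℝ n (fun ξ => m (r • ξ) * η ξ) x‖ ≤ r * C := by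
  choose M hM0 hM using hmb
  refine ⟨4 / 3 * ∑ i ∈ Finset.range (n + 1),
    (n.choose i : ℝ) * M i * SchwartzMap.seminorm ℝ (k + 1) (n - i) η, mul_nonneg (by norm_num)
      (Finset.sum_nonneg fun i _ => mul_nonneg (mul_nonneg (by positivity) (hM0 i))
        (apply_nonneg _ _)), fun r hr hr1 x => ?_⟩
  have hS : 0 ≤ ∑ i ∈ Finset.range (n + 1),
    (n.choose i : ℝ) * M i * SchwartzMap.seminorm ℝ (k + 1) (n - i) η :=
    Finset.sum_nonneg fun i _ => mul_nonneg (mul_nonneg (by positivity) (hM0 i))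
      (apply_nonneg _ _)
  rcases lt_or_ge (r * ‖x‖) (3 / 4) with hx | hx
  · have he : (fun ξ => m (r • ξ) * η ξ) =ᶠ[𝓝 x] fun _ => 0 := by
      have hc : ContinuousAt (fun ξ : 𝔼 => r * ‖ξ‖) x := by fun_prop
      filter_upwards [hc.eventually_lt continuousAt_const hx] with ξ hξ
      have hξ' : r • ξ ∈ Metric.closedBall (0 : EuclideanSpace ℝ (Fin d)) (3 / 4) := by
        rw [mem_closedBall_zero_iff, norm_smul, Real.norm_of_nonneg hr.le]
        exact hξ.le
      rw [hm0 _ hξ', zero_mul]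
    rw [(he.iteratedFDeriv ℝ n).eq_of_nhds]
    have : iteratedFDeriv ℝ n (fun _ : 𝔼 => (0 : ℂ)) x = 0 := by
      simp
    rw [this, norm_zero, mul_zero]
    positivity
  · have hmr : ContDiff ℝ ∞ (fun ξ : 𝔼 => m (r • ξ)) := hm.comp (contDiff_const_smul r)
    have h1 := norm_iteratedFDeriv_mul_le hmr (η.smooth ⊤) x (n := n) (by exact_mod_cast le_top)
    have hxk : ‖x‖ ^ k ≤ 4 / 3 * r * ‖x‖ ^ (k + 1) := by
      have : 1 ≤ 4 / 3 * (r * ‖x‖) := by linarith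
      calc ‖x‖ ^ k = 1 * ‖x‖ ^ k := (one_mul _).symm
        _ ≤ 4 / 3 * (r * ‖x‖) * ‖x‖ ^ k := by gcongr
        _ = _ := by ring
    calc ‖x‖ ^ k * ‖iteratedFDeriv ℝ n (fun ξ => m (r • ξ) * η ξ) x‖
        ≤ 4 / 3 * r * ‖x‖ ^ (k + 1) * ∑ i ∈ Finset.range (n + 1),
          (n.choose i : ℝ) * M i * ‖iteratedFDeriv ℝ (n - i) η x‖ := by
          refine mul_le_mul hxk (h1.trans (Finset.sum_le_sum fun i _ => ?_)) (norm_nonneg _)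
            (by positivity)
          gcongr
          rw [iteratedFDeriv_comp_const_smul r (hm.of_le (by exact_mod_cast le_top)), norm_smul,
            norm_pow, Real.norm_of_nonneg hr.le]
          exact (mul_le_of_le_one_left (norm_nonneg _) (pow_le_one₀ hr.le hr1)).trans (hM i _)
      _ = 4 / 3 * r * ∑ i ∈ Finset.range (n + 1),
          (n.choose i : ℝ) * M i * (‖x‖ ^ (k + 1) * ‖iteratedFDeriv ℝ (n - i) η x‖) := by
          rw [mul_assoc, Finset.mul_sum]
          congr 1
          exact Finset.sum_congr rfl fun i _ => by ring
      _ ≤ 4 / 3 * r * ∑ i ∈ Finset.range (n + 1),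
          (n.choose i : ℝ) * M i * SchwartzMap.seminorm ℝ (k + 1) (n - i) η := by
          gcongr with i _
          · have := hM0 i
            positivity
          · exact η.le_seminorm ℝ (k + 1) (n - i) x
      _ = _ := by ring

theorem tendsto_scale : Tendsto (fun j : ℤ => (2 : ℝ) ^ (-j) * (2 * Real.pi)) atTop (𝓝 0) := by
  rw [← zero_mul (2 * Real.pi)]
  refine Tendsto.mul_const _ ?_
  have h : Tendsto (fun j : ℤ => Real.exp (-(Real.log 2 * (j : ℝ)))) atTop (𝓝 0) :=
    Real.tendsto_exp_neg_atTop_nhds_zero.comp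
      (tendsto_intCast_atTop_atTop.const_mul_atTop (Real.log_pos one_lt_two))
  refine h.congr fun j => ?_
  rw [← Real.rpow_intCast, Real.rpow_def_of_pos two_pos]
  push_cast
  ring_nf

theorem tendsto_smulLeftCLM_dilatedSymbol {χ : 𝔼 → ℝ} (hχ : IsCutoff χ) (η : 𝓢(𝔼, ℂ)) :
    Tendsto (fun j : ℤ => SchwartzMap.smulLeftCLM ℂ (dilatedSymbol χ j) η) atTop (𝓝 η) := by
  rw [(schwartz_withSeminorms ℝ 𝔼 ℂ).tendsto_nhds]
  rintro ⟨k, n⟩ ε hε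
  obtain ⟨C, hC0, hC⟩ := exists_pow_mul_norm_iteratedFDeriv_le
    (m := fun ξ => 1 - hχ.toSchwartz ξ) (contDiff_const.sub (hχ.toSchwartz.smooth ⊤))
    (fun ξ hξ => by simp [hχ.toSchwartz_apply, hχ.eq_one ξ hξ])
    (exists_norm_iteratedFDeriv_one_sub_le _) η k n
  have hlim : Tendsto (fun j : ℤ => (2 : ℝ) ^ (-j) * (2 * Real.pi) * C) atTop (𝓝 0) := by
    simpa using tendsto_scale.mul_const C
  filter_upwards [hlim.eventually_lt_const hε, tendsto_scale.eventually_le_const one_pos]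
    with j hj hj1
  refine lt_of_le_of_lt ?_ hj
  rw [SchwartzMap.schwartzSeminormFamily_apply]
  refine SchwartzMap.seminorm_le_bound ℝ k n _ (mul_nonneg (scale_pos j).le hC0) fun x => ?_
  have hfun : ((SchwartzMap.smulLeftCLM ℂ (dilatedSymbol χ j) η - η : 𝓢(𝔼, ℂ)) : 𝔼 → ℂ)
      = -fun ξ => (1 - hχ.toSchwartz (((2 : ℝ) ^ (-j) * (2 * Real.pi)) • ξ)) * η ξ := by
    ext ξ
    have : (SchwartzMap.smulLeftCLM ℂ (dilatedSymbol χ j) η - η : 𝓢(𝔼, ℂ)) ξ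
      = SchwartzMap.smulLeftCLM ℂ (dilatedSymbol χ j) η ξ - η ξ := rfl
    rw [this, SchwartzMap.smulLeftCLM_apply_apply (hχ.hasTemperateGrowth j), Pi.neg_apply,
      hχ.toSchwartz_apply, dilatedSymbol, smul_eq_mul]
    ring
  rw [hfun, iteratedFDeriv_neg_apply, norm_neg]
  exact hC _ (scale_pos j) hj1 x

theorem tendsto_lowCut_apply {χ : 𝔼 → ℝ} (hχ : IsCutoff χ) (z : 𝓢'(𝔼, ℂ)) (θ : 𝓢(𝔼, ℂ)) :
    Tendsto (fun j : ℤ => lowCut χ j z θ) atTop (𝓝 (z θ)) := by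
  have h := tendsto_smulLeftCLM_dilatedSymbol hχ (𝓕⁻ θ)
  have hF : Continuous (𝓕 : 𝓢(𝔼, ℂ) → 𝓢(𝔼, ℂ)) := FourierTransform.continuous_fourier
  have hz : Continuous (fun η : 𝓢(𝔼, ℂ) => z η) := z.continuous
  have hzF := ((hz.comp hF).tendsto _).comp h
  rwa [Function.comp_apply, FourierTransform.fourier_fourierInv_eq] at hzF

/-! ### Bernstein's inequality -/

theorem rpow_scale_add_two (i : ℤ) (t : ℝ) :
    ((2 : ℝ) ^ (-(i + 2)) * (2 * Real.pi)) ^ (-t)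
      = (2 : ℝ) ^ ((i : ℝ) * t) * (Real.pi / 2) ^ (-t) := by
  have h : (2 : ℝ) ^ (-(i + 2)) * (2 * Real.pi) = (2 : ℝ) ^ (-(i : ℝ)) * (Real.pi / 2) := by
    rw [neg_add, zpow_add₀ two_ne_zero, ← Real.rpow_intCast 2 (-i)]
    push_cast
    norm_num
    ring
  rw [h, Real.mul_rpow (by positivity) (by positivity), ← Real.rpow_mul two_pos.le, neg_mul_neg]

/-- Every dyadic block of `L^q` type, `q > 1`, is a bounded function. -/
theorem exists_bernstein {χ : 𝔼 → ℝ} (hχ : IsCutoff χ) {q : ℝ≥0∞} (hq : 1 < q) :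
    ∃ C : ℝ≥0, ∀ (z : 𝓢'(𝔼, ℂ)) (i : ℤ), lpNorm q (block χ i z) < ⊤ →
      ∃ h : 𝔼 → ℂ, IsLpFunction ⊤ (block χ i z) h ∧
        ∀ x, ‖h x‖ₑ ≤ C * blockNorm χ (d / q.toReal) q z i := by
  have hc : ENNReal.HolderConjugate (1 - q⁻¹)⁻¹ q :=
    (ENNReal.HolderConjugate.inv_one_sub_inv' hq.le).symm
  -- The hypothesis `q > 1` makes the conjugate exponent finite, as the dilation formula requires.
  have hq' : (1 - q⁻¹)⁻¹ ≠ ⊤ := by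
    rw [Ne, ENNReal.inv_eq_top, tsub_eq_zero_iff_le, not_le]
    exact ENNReal.inv_lt_one.2 hq
  generalize (1 - q⁻¹)⁻¹ = q' at hc hq'
  set K := eLpNorm (𝓕 hχ.toSchwartz : 𝓢(𝔼, ℂ)) q' volume with hK
  have hKt : K < ⊤ := (𝓕 hχ.toSchwartz : 𝓢(𝔼, ℂ)).eLpNorm_lt_top q' volume
  refine ⟨(ENNReal.ofReal ((Real.pi / 2) ^ (-(d / q.toReal))) * K).toNNReal, fun z i hz => ?_⟩
  rw [ENNReal.coe_toNNReal (ENNReal.mul_ne_top ENNReal.ofReal_ne_top hKt.ne)]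
  obtain ⟨f, hf⟩ := exists_isLpFunction_of_lpNorm_lt_top hz
  -- As `Δ̇_i = Ṡ_{i+2} Δ̇_i`, the block is its own convolution with a dilate of one fixed kernel,
  -- and Hölder applies pointwise.
  have hm := hf.multiplier hq.le (hχ.symbol (i + 2))
  rw [hχ.coe_symbol, ← lowCut_eq, lowCut_add_two_block hχ] at hm
  refine ⟨_, hm, fun x => ?_⟩
  refine (enorm_integral_le_lintegral_enorm _).trans ((enorm_kernelIntegral_le (q := q) (q' := q')
    (((𝓕 (hχ.symbol (i + 2)) : 𝓢(𝔼, ℂ)).memLp q' volume).1) hf.1.1 x).trans ?_)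
  have hs : eLpNorm (𝓕 (hχ.symbol (i + 2)) : 𝓢(𝔼, ℂ)) q' volume
      = ENNReal.ofReal (((2 : ℝ) ^ (-(i + 2)) * (2 * Real.pi)) ^ (-(d / q.toReal))) * K := by
    rw [SchwartzMap.fourier_coe, hK, SchwartzMap.fourier_coe]
    exact eLpNorm_fourier_comp_smul (q := q) hq' hχ.toSchwartz (scale_pos (i + 2))
  rw [hs, rpow_scale_add_two, ENNReal.ofReal_mul (by positivity), blockNorm]
  have hle : eLpNorm f q volume ≤ lpNorm q (block χ i z) := eLpNorm_le_lpNorm hq.le hq.le hf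
  exact (mul_le_mul_right hle _).trans (by ring_nf; rfl)

/-! ### Absolutely and uniformly convergent series of functions indexed by `ℤ` -/

/-- A family of measurable functions that is bounded by a summable family of constants. -/
structure IsNormalSeries (β : ℤ → 𝔼 → ℂ) (B : ℤ → ℝ) : Prop where
  aestronglyMeasurable : ∀ i, AEStronglyMeasurable (β i)
  norm_le : ∀ i x, ‖β i x‖ ≤ B i
  summable : Summable B

/-- The partial sum `∑_{i < k} β_i`. -/
def partialSum (β : ℤ → 𝔼 → ℂ) (k : ℤ) (x : 𝔼) : ℂ := ∑' i, if i < k then β i x else 0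

/-- The sum `∑_i β_i`. -/
def fullSum (β : ℤ → 𝔼 → ℂ) (x : 𝔼) : ℂ := ∑' i, β i x

namespace IsNormalSeries

variable {β : ℤ → EuclideanSpace ℝ (Fin d) → ℂ} {B : ℤ → ℝ}

theorem nonneg (h : IsNormalSeries β B) (i : ℤ) : 0 ≤ B i :=
  (norm_nonneg _).trans (h.norm_le i 0)

theorem norm_ite_le (h : IsNormalSeries β B) (k i : ℤ) (x : 𝔼) :
    ‖if i < k then β i x else 0‖ ≤ B i := by
  split_ifs
  · exact h.norm_le i x
  · simpa using h.nonneg i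

theorem summable_ite (h : IsNormalSeries β B) (k : ℤ) (x : 𝔼) :
    Summable fun i => if i < k then β i x else 0 :=
  Summable.of_norm_bounded h.summable fun i => h.norm_ite_le k i x

theorem norm_partialSum_le (h : IsNormalSeries β B) (k : ℤ) (x : 𝔼) :
    ‖partialSum β k x‖ ≤ ∑' i, B i :=
  tsum_of_norm_bounded h.summable.hasSum fun i => h.norm_ite_le k i x

theorem norm_fullSum_le (h : IsNormalSeries β B) (x : 𝔼) : ‖fullSum β x‖ ≤ ∑' i, B i :=
  tsum_of_norm_bounded h.summable.hasSum fun i => h.norm_le i x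

theorem partialSum_add_one (h : IsNormalSeries β B) (k : ℤ) (x : 𝔼) :
    partialSum β (k + 1) x = partialSum β k x + β k x := by
  rw [← sub_eq_iff_eq_add', partialSum, partialSum,
    ← (h.summable_ite (k + 1) x).tsum_sub (h.summable_ite k x), tsum_eq_single k]
  · simp
  · intro i hi
    have : i < k + 1 ↔ i < k := by omega
    simp [this]

theorem partialSum_eq_add_sum (h : IsNormalSeries β B) {j k : ℤ} (hjk : j ≤ k) (x : 𝔼) :
    partialSum β k x = partialSum β j x + ∑ i ∈ Finset.Ico j k, β i x := by
  rw [← sub_eq_iff_eq_add', partialSum, partialSum,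
    ← (h.summable_ite k x).tsum_sub (h.summable_ite j x), tsum_eq_sum (s := Finset.Ico j k)]
  · refine Finset.sum_congr rfl fun i hi => ?_
    rw [Finset.mem_Ico] at hi
    simp [hi.2, hi.1.not_gt]
  · intro i hi
    rw [Finset.mem_Ico] at hi
    have : i < k ↔ i < j := by omega
    simp [this]

theorem tendsto_partialSum_atTop (h : IsNormalSeries β B) (x : 𝔼) :
    Tendsto (fun k => partialSum β k x) atTop (𝓝 (fullSum β x)) := by
  refine tendsto_tsum_of_dominated_convergence h.summable (fun i => ?_)
    (Eventually.of_forall fun k i => h.norm_ite_le k i x)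
  refine tendsto_const_nhds.congr' ?_
  filter_upwards [eventually_gt_atTop i] with k hk
  rw [if_pos hk]

theorem tendsto_partialSum_atBot (h : IsNormalSeries β B) (x : 𝔼) :
    Tendsto (fun k => partialSum β k x) atBot (𝓝 0) := by
  have h0 : (∑' _ : ℤ, (0 : ℂ)) = 0 := tsum_zero
  rw [← h0]
  refine tendsto_tsum_of_dominated_convergence h.summable (fun i => ?_)
    (Eventually.of_forall fun k i => h.norm_ite_le k i x)
  refine tendsto_const_nhds.congr' ?_
  filter_upwards [eventually_le_atBot i] with k hk
  rw [if_neg hk.not_gt]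

theorem tendsto_sum_Ico (h : IsNormalSeries β B) (k : ℤ) (x : 𝔼) :
    Tendsto (fun j => ∑ i ∈ Finset.Ico j k, β i x) atBot (𝓝 (partialSum β k x)) := by
  have h1 := (h.tendsto_partialSum_atBot x).const_sub (partialSum β k x)
  rw [sub_zero] at h1
  refine h1.congr' ?_
  filter_upwards [eventually_le_atBot k] with j hj
  rw [h.partialSum_eq_add_sum hj, add_sub_cancel_left]

theorem aestronglyMeasurable_sum (h : IsNormalSeries β B) (s : Finset ℤ) :
    AEStronglyMeasurable (fun x => ∑ i ∈ s, β i x) :=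
  Finset.aestronglyMeasurable_fun_sum s fun i _ => h.aestronglyMeasurable i

theorem aestronglyMeasurable_partialSum (h : IsNormalSeries β B) (k : ℤ) :
    AEStronglyMeasurable (partialSum β k) :=
  aestronglyMeasurable_of_tendsto_ae atBot
    (fun j => h.aestronglyMeasurable_sum (Finset.Ico j k))
    (ae_of_all _ fun x => h.tendsto_sum_Ico k x)

theorem aestronglyMeasurable_fullSum (h : IsNormalSeries β B) :
    AEStronglyMeasurable (fullSum β) :=
  aestronglyMeasurable_of_tendsto_ae atTop h.aestronglyMeasurable_partialSum
    (ae_of_all _ fun x => h.tendsto_partialSum_atTop x)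

theorem memLp_partialSum (h : IsNormalSeries β B) (k : ℤ) : MemLp (partialSum β k) ⊤ :=
  memLp_top_of_bound (h.aestronglyMeasurable_partialSum k) _
    (ae_of_all _ fun x => h.norm_partialSum_le k x)

theorem memLp_fullSum (h : IsNormalSeries β B) : MemLp (fullSum β) ⊤ :=
  memLp_top_of_bound h.aestronglyMeasurable_fullSum _ (ae_of_all _ fun x => h.norm_fullSum_le x)

/-- Minkowski for the finite sums over `[j, k)`, then Fatou as `j → -∞`. -/
theorem eLpNorm_partialSum_le (h : IsNormalSeries β B) {r : ℝ≥0∞} (hr : 1 ≤ r) (k : ℤ) :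
    eLpNorm (partialSum β k) r volume ≤ ∑' i : Set.Iio k, eLpNorm (β i) r volume := by
  refine Lp.eLpNorm_le_of_ae_tendsto (u := atBot)
    (f := fun j x => ∑ i ∈ Finset.Ico j k, β i x) (Eventually.of_forall fun j => ?_)
    (fun j => h.aestronglyMeasurable_sum _) (ae_of_all _ fun x => h.tendsto_sum_Ico k x)
  have h1 : eLpNorm (fun x => ∑ i ∈ Finset.Ico j k, β i x) r volume
      ≤ ∑ i ∈ Finset.Ico j k, eLpNorm (β i) r volume := by
    have := eLpNorm_sum_le (s := Finset.Ico j k) (f := β) (p := r) (μ := volume)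
      (fun i _ => h.aestronglyMeasurable i) hr
    rwa [Finset.sum_fn] at this
  refine h1.trans ?_
  rw [tsum_subtype (Set.Iio k) fun i => eLpNorm (β i) r volume]
  refine le_trans (Finset.sum_le_sum fun i hi => ?_) (ENNReal.sum_le_tsum (Finset.Ico j k))
  rw [Set.indicator_of_mem (Set.mem_Iio.2 (Finset.mem_Ico.1 hi).2)]

theorem tendsto_integral_partialSum (h : IsNormalSeries β B) {u : 𝔼 → ℂ} (hu : Integrable u) :
    Tendsto (fun k => ∫ x, u x * partialSum β k x) atTop (𝓝 (∫ x, u x * fullSum β x)) := by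
  refine tendsto_integral_filter_of_dominated_convergence (fun x => ‖u x‖ * ∑' i, B i)
    (Eventually.of_forall fun k => hu.1.mul (h.aestronglyMeasurable_partialSum k))
    (Eventually.of_forall fun k => ae_of_all _ fun x => ?_) (hu.norm.mul_const _)
    (ae_of_all _ fun x => (h.tendsto_partialSum_atTop x).const_mul _)
  rw [norm_mul]
  exact mul_le_mul_of_nonneg_left (h.norm_partialSum_le k x) (norm_nonneg _)

theorem tendsto_integral_partialSum_atBot (h : IsNormalSeries β B) {u : 𝔼 → ℂ}
    (hu : Integrable u) : Tendsto (fun k => ∫ x, u x * partialSum β k x) atBot (𝓝 0) := by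
  have h0 : (∫ x, u x * 0) = 0 := by simp
  rw [← h0]
  refine tendsto_integral_filter_of_dominated_convergence (fun x => ‖u x‖ * ∑' i, B i)
    (Eventually.of_forall fun k => hu.1.mul (h.aestronglyMeasurable_partialSum k))
    (Eventually.of_forall fun k => ae_of_all _ fun x => ?_) (hu.norm.mul_const _)
    (ae_of_all _ fun x => (h.tendsto_partialSum_atBot x).const_mul _)
  rw [norm_mul]
  exact mul_le_mul_of_nonneg_left (h.norm_partialSum_le k x) (norm_nonneg _)

theorem tendsto_integral_partialSum_mul {γ : ℤ → 𝔼 → ℂ} {G : ℤ → ℝ} (h : IsNormalSeries β B)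
    (h' : IsNormalSeries γ G) {u : 𝔼 → ℂ} (hu : Integrable u) :
    Tendsto (fun k => ∫ x, u x * (partialSum β k x * partialSum γ k x)) atTop
      (𝓝 (∫ x, u x * (fullSum β x * fullSum γ x))) := by
  refine tendsto_integral_filter_of_dominated_convergence
    (fun x => ‖u x‖ * ((∑' i, B i) * ∑' i, G i))
    (Eventually.of_forall fun k => hu.1.mul ((h.aestronglyMeasurable_partialSum k).mul
      (h'.aestronglyMeasurable_partialSum k)))
    (Eventually.of_forall fun k => ae_of_all _ fun x => ?_) (hu.norm.mul_const _)
    (ae_of_all _ fun x =>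
      ((h.tendsto_partialSum_atTop x).mul (h'.tendsto_partialSum_atTop x)).const_mul _)
  rw [norm_mul, norm_mul]
  exact mul_le_mul_of_nonneg_left (mul_le_mul (h.norm_partialSum_le k x)
    (h'.norm_partialSum_le k x) (norm_nonneg _)
    ((norm_nonneg _).trans (h.norm_partialSum_le k x))) (norm_nonneg _)

end IsNormalSeries

/-! ### Littlewood-Paley decomposition -/

theorem MemSh.tendsto_apply {χ : 𝔼 → ℝ} {z : 𝓢'(𝔼, ℂ)} (hz : MemSh χ z) (θ : 𝓢(𝔼, ℂ)) :
    Tendsto (fun j : ℤ => lowCut χ j z θ) atBot (𝓝 0) := by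
  have h1 : Tendsto (fun j : ℤ => (lpNorm ⊤ (lowCut χ j z)).toReal * ∫ x, ‖θ x‖) atBot (𝓝 0) := by
    have := ((ENNReal.tendsto_toReal ENNReal.zero_ne_top).comp hz).mul_const (∫ x, ‖θ x‖)
    simpa using this
  refine squeeze_zero_norm' ?_ h1
  filter_upwards [hz.eventually_lt_const ENNReal.zero_lt_top] with j hj
  exact norm_apply_le_lpNorm_top hj θ

/-- In `𝓢'_h`, the low frequency cut-offs are the partial sums of the dyadic blocks. -/
theorem isLpFunction_lowCut {χ : 𝔼 → ℝ} (hχ : IsCutoff χ) {z : 𝓢'(𝔼, ℂ)} (hz : MemSh χ z)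
    {β : ℤ → 𝔼 → ℂ} {B : ℤ → ℝ} (h : IsNormalSeries β B)
    (hβ : ∀ i, IsLpFunction ⊤ (block χ i z) (β i)) (k : ℤ) :
    IsLpFunction ⊤ (lowCut χ k z) (partialSum β k) := by
  refine ⟨h.memLp_partialSum k, fun θ => ?_⟩
  have hi : ∀ j, Integrable fun x => θ x * partialSum β j x := fun j =>
    θ.integrable.mul_bdd (c := ∑' i, B i) (h.aestronglyMeasurable_partialSum j)
      (ae_of_all _ fun x => h.norm_partialSum_le j x)
  set D : ℤ → ℂ := fun j => lowCut χ j z θ - ∫ x, θ x * partialSum β j x with hD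
  -- Both terms of `D` gain the same block from `j` to `j + 1`, so `D` is constant on `ℤ`; its limit
  -- at `-∞` is zero.
  have hper : Function.Periodic D 1 := fun j => by
    have h1 : lowCut χ (j + 1) z θ = lowCut χ j z θ + block χ j z θ := by
      rw [lowCut_succ_eq_add hχ]; rfl
    have h2 : ∫ x, θ x * partialSum β (j + 1) x
        = (∫ x, θ x * partialSum β j x) + ∫ x, θ x * β j x := by
      rw [← integral_add (hi j) ((hβ j).integrable le_top θ)]
      simp_rw [h.partialSum_add_one, mul_add]
    simp only [hD, h1, h2, (hβ j).2 θ]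
    ring
  have hc : ∀ j, D j = D 0 := fun j => by simpa using hper.int_mul_eq j
  have hlim : Tendsto D atBot (𝓝 0) := by
    simpa using (hz.tendsto_apply θ).sub (h.tendsto_integral_partialSum_atBot θ.integrable)
  have h0 : D 0 = 0 := by
    refine tendsto_nhds_unique ?_ hlim
    rw [funext hc]
    exact tendsto_const_nhds
  exact sub_eq_zero.1 ((hc k).trans h0)

theorem isLpFunction_fullSum {χ : 𝔼 → ℝ} (hχ : IsCutoff χ) {z : 𝓢'(𝔼, ℂ)} (hz : MemSh χ z)
    {β : ℤ → 𝔼 → ℂ} {B : ℤ → ℝ} (h : IsNormalSeries β B)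
    (hβ : ∀ i, IsLpFunction ⊤ (block χ i z) (β i)) : IsLpFunction ⊤ z (fullSum β) := by
  refine ⟨h.memLp_fullSum, fun θ => ?_⟩
  refine tendsto_nhds_unique (tendsto_lowCut_apply hχ z θ) ?_
  refine (h.tendsto_integral_partialSum θ.integrable).congr fun k => ?_
  exact ((isLpFunction_lowCut hχ hz h hβ k).2 θ).symm

/-- The dyadic blocks of an element of `Ḃ^{d/q}_{q,1}` form a normally convergent series. -/
theorem exists_isNormalSeries {χ : 𝔼 → ℝ} (hχ : IsCutoff χ) {q : ℝ≥0∞} (hq : 1 < q) :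
    ∃ C : ℝ≥0, ∀ z : 𝓢'(𝔼, ℂ), MemBesov χ (d / q.toReal) q z →
      ∃ (β : ℤ → 𝔼 → ℂ) (B : ℤ → ℝ), IsNormalSeries β B ∧
        (∀ i, IsLpFunction ⊤ (block χ i z) (β i)) ∧
        ∀ i x, ‖β i x‖ₑ ≤ C * blockNorm χ (d / q.toReal) q z i := by
  obtain ⟨C, hC⟩ := exists_bernstein hχ hq
  refine ⟨C, fun z hz => ?_⟩
  have hbt : ∀ i, blockNorm χ (d / q.toReal) q z i < ⊤ := fun i =>
    (ENNReal.le_tsum i).trans_lt hz.2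
  have hlt : ∀ i, lpNorm q (block χ i z) < ⊤ := fun i => by
    by_contra h
    have h1 := hbt i
    rw [blockNorm, not_lt_top_iff.1 h, ENNReal.mul_top] at h1
    · exact lt_irrefl _ h1
    · have : (0 : ℝ) < (2 : ℝ) ^ ((i : ℝ) * (d / q.toReal)) := by positivity
      simpa using this
  choose β hβ hb using fun i => hC z i (hlt i)
  refine ⟨β, fun i => (C * blockNorm χ (d / q.toReal) q z i).toReal,
    ⟨fun i => (hβ i).1.1, fun i x => ?_, ?_⟩, hβ, hb⟩
  · have := ENNReal.toReal_mono (ENNReal.mul_ne_top ENNReal.coe_ne_top (hbt i).ne) (hb i x)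
    simpa using this
  · refine ENNReal.summable_toReal ?_
    rw [ENNReal.tsum_mul_left]
    exact ENNReal.mul_ne_top ENNReal.coe_ne_top hz.2.ne

/-! ### The dyadic blocks of a product -/

/-- The transpose of `Δ̇_j`, acting on test functions. -/
def testBlock (χ : 𝔼 → ℝ) (j : ℤ) (θ : 𝓢(𝔼, ℂ)) : 𝓢(𝔼, ℂ) :=
  𝓕 (SchwartzMap.smulLeftCLM ℂ (dilatedSymbol χ (j + 1) - dilatedSymbol χ j) (𝓕⁻ θ))

theorem block_apply (χ : 𝔼 → ℝ) (j : ℤ) (z : 𝓢'(𝔼, ℂ)) (θ : 𝓢(𝔼, ℂ)) :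
    block χ j z θ = z (testBlock χ j θ) := by
  rw [block_eq_multiplier]
  rfl

theorem norm_dilatedSymbol_sub_le {χ : 𝔼 → ℝ} (hχ : IsCutoff χ) (j k : ℤ) (ξ : 𝔼) :
    ‖(dilatedSymbol χ j - dilatedSymbol χ k) ξ‖ ≤ 1 := by
  rw [Pi.sub_apply, dilatedSymbol, dilatedSymbol, ← Complex.ofReal_sub, Complex.norm_real,
    Real.norm_eq_abs, abs_le]
  have h1 := hχ.range_mem (((2 : ℝ) ^ (-j) * (2 * Real.pi)) • ξ)
  have h2 := hχ.range_mem (((2 : ℝ) ^ (-k) * (2 * Real.pi)) • ξ)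
  constructor <;> linarith [h1.1, h1.2, h2.1, h2.2]

theorem eLpNorm_fourier_two (w : 𝓢(𝔼, ℂ)) :
    eLpNorm (𝓕 w : 𝓢(𝔼, ℂ)) 2 volume = eLpNorm w 2 volume := by
  have h := SchwartzMap.norm_fourier_toL2_eq w
  rw [SchwartzMap.norm_toLp, SchwartzMap.norm_toLp] at h
  exact (ENNReal.toReal_eq_toReal_iff' (SchwartzMap.eLpNorm_lt_top _ 2 volume).ne
    (w.eLpNorm_lt_top 2 volume).ne).1 h

/-- Plancherel, the symbol being bounded by one. -/
theorem eLpNorm_testBlock_le {χ : 𝔼 → ℝ} (hχ : IsCutoff χ) (j : ℤ) (θ : 𝓢(𝔼, ℂ)) :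
    eLpNorm (testBlock χ j θ) 2 volume ≤ eLpNorm θ 2 volume := by
  rw [testBlock, eLpNorm_fourier_two]
  have h : eLpNorm θ 2 volume = eLpNorm (𝓕⁻ θ : 𝓢(𝔼, ℂ)) 2 volume := by
    rw [← eLpNorm_fourier_two (𝓕⁻ θ), FourierTransform.fourier_fourierInv_eq]
  rw [h]
  refine eLpNorm_mono fun ξ => ?_
  rw [SchwartzMap.smulLeftCLM_apply_apply
    ((hχ.hasTemperateGrowth _).sub (hχ.hasTemperateGrowth _)), norm_smul]
  exact mul_le_of_le_one_left (norm_nonneg _) (norm_dilatedSymbol_sub_le hχ _ _ ξ)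

/-- The character is absorbed into a translation of `w`. The spectrum of `z` can then be compared
with the translated support of `w`, without convolving distributions. -/
theorem fourierInv_mul_fourier (w : 𝓢(𝔼, ℂ)) {z : 𝓢'(𝔼, ℂ)} {F : 𝔼 → ℂ}
    (hF : IsLpFunction ⊤ z F) (ξ : 𝔼) :
    𝓕⁻ (fun x => (𝓕 w : 𝓢(𝔼, ℂ)) x * F x) ξ
      = z (𝓕 (SchwartzMap.compSubConstCLM ℂ (-ξ) w)) := by
  rw [hF.2, Real.fourierInv_eq]
  refine integral_congr_ae (ae_of_all _ fun x => ?_)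
  have h := congrFun (VectorFourier.fourierIntegral_comp_add_right Real.fourierChar
    (volume : Measure 𝔼) (innerₗ 𝔼) w ξ) x
  have h1 : (𝓕 (SchwartzMap.compSubConstCLM ℂ (-ξ) w) : 𝓢(𝔼, ℂ)) x
      = VectorFourier.fourierIntegral Real.fourierChar volume (innerₗ 𝔼)
        (w ∘ fun v => v + ξ) x := by
    rw [SchwartzMap.fourier_coe]
    refine congrArg (fun v : 𝔼 → ℂ => 𝓕 v x) (funext fun η => ?_)
    simp
  have h2 : (𝓕 w : 𝓢(𝔼, ℂ)) x
      = VectorFourier.fourierIntegral Real.fourierChar volume (innerₗ 𝔼) w x := rfl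
  simp only
  rw [h1, h, ← h2, innerₗ_apply_apply, real_inner_comm, smul_mul_assoc]

theorem scale_add_three (m : ℤ) :
    (2 : ℝ) ^ (-(m + 3)) * (2 * Real.pi) = 1 / 8 * ((2 : ℝ) ^ (-m) * (2 * Real.pi)) := by
  rw [neg_add, zpow_add₀ two_ne_zero]
  norm_num
  ring

/-- The product of two functions with spectrum in `{|ξ| < 4/3 · 2^m}` has no component in the
dyadic block of index `m + 3`. -/
theorem integral_testBlock_mul_lowCut {χ : 𝔼 → ℝ} (hχ : IsCutoff χ) {a b : 𝓢'(𝔼, ℂ)} {m : ℤ}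
    {F G : 𝔼 → ℂ} (hF : IsLpFunction ⊤ (lowCut χ m a) F) (hG : IsLpFunction ⊤ (lowCut χ m b) G)
    (θ : 𝓢(𝔼, ℂ)) : ∫ x, testBlock χ (m + 3) θ x * (F x * G x) = 0 := by
  have hu : Integrable fun x => testBlock χ (m + 3) θ x * F x := hF.integrable le_top _
  have h := integral_mul_eq_zero_of_multiplier_eq hG (hχ.symbol (m + 1))
    (by rw [hχ.coe_symbol]; exact lowCut_succ_lowCut hχ m b) hu fun ξ => ?_
  · simpa only [mul_assoc] using h
  rw [hχ.coe_symbol]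
  rcases le_or_gt (4 / 3) ((2 : ℝ) ^ (-(m + 1)) * (2 * Real.pi) * ‖ξ‖) with hξ | hξ
  · rw [dilatedSymbol_eq_zero hχ hξ, zero_mul]
  rw [scale_succ] at hξ
  rw [testBlock, fourierInv_mul_fourier _ hF, lowCut_eq,
    TemperedDistribution.fourierMultiplierCLM_apply_apply, FourierTransform.fourierInv_fourier_eq]
  have h0 : SchwartzMap.smulLeftCLM ℂ (dilatedSymbol χ m) (SchwartzMap.compSubConstCLM ℂ (-ξ)
      (SchwartzMap.smulLeftCLM ℂ (dilatedSymbol χ (m + 3 + 1) - dilatedSymbol χ (m + 3))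
        (𝓕⁻ θ))) = 0 := by
    ext η
    rw [SchwartzMap.smulLeftCLM_apply_apply (hχ.hasTemperateGrowth m),
      SchwartzMap.compSubConstCLM_apply, SchwartzMap.smulLeftCLM_apply_apply
        ((hχ.hasTemperateGrowth _).sub (hχ.hasTemperateGrowth _)), sub_neg_eq_add]
    rcases le_or_gt (4 / 3) ((2 : ℝ) ^ (-m) * (2 * Real.pi) * ‖η‖) with hη | hη
    · rw [dilatedSymbol_eq_zero hχ hη, zero_smul]
      rfl
    · have hs := scale_pos m
      -- Here `4 = 4/3 + 8/3`, the second radius being doubled by the use of `Ṡ_{m+1}`. At scale `m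
      -- + 3` it becomes `1/2 ≤ 3/4`, so both cut-offs in the block equal one and cancel.
      have hn : (2 : ℝ) ^ (-m) * (2 * Real.pi) * ‖η + ξ‖ ≤ 4 := by
        have := mul_le_mul_of_nonneg_left (norm_add_le η ξ) hs.le
        rw [mul_add] at this
        linarith
      have h1 : dilatedSymbol χ (m + 3) (η + ξ) = 1 := by
        refine dilatedSymbol_eq_one hχ ?_
        rw [scale_add_three]
        linarith
      have h2 : dilatedSymbol χ (m + 3 + 1) (η + ξ) = 1 := by
        refine dilatedSymbol_eq_one hχ ?_
        rw [scale_succ, scale_add_three]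
        linarith
      rw [Pi.sub_apply, h1, h2, sub_self, zero_smul, smul_zero]
      rfl
  rw [h0, ← FourierTransform.fourierCLM_apply (R := ℂ), map_zero, map_zero, mul_zero]

theorem enorm_integral_mul_le_two {u v : 𝔼 → ℂ} (hu : AEStronglyMeasurable u)
    (hv : AEStronglyMeasurable v) :
    ‖∫ x, u x * v x‖ₑ ≤ eLpNorm u 2 volume * eLpNorm v 2 volume := by
  refine (enorm_integral_le_lintegral_enorm _).trans ?_
  have h := eLpNorm_smul_le_mul_eLpNorm (p := 2) (q := 2) (r := 1) hv hu
  rw [eLpNorm_one_eq_lintegral_enorm] at h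
  exact h

/-- The `k`-th increment of the product of the partial sums of two series. -/
def increment (β γ : ℤ → 𝔼 → ℂ) (k : ℤ) (x : 𝔼) : ℂ :=
  partialSum β (k + 1) x * γ k x + β k x * partialSum γ k x

theorem IsNormalSeries.partialSum_mul_add_one {β γ : ℤ → 𝔼 → ℂ} {B G : ℤ → ℝ}
    (hβ : IsNormalSeries β B) (hγ : IsNormalSeries γ G) (k : ℤ) (x : 𝔼) :
    partialSum β (k + 1) x * partialSum γ (k + 1) x
      = partialSum β k x * partialSum γ k x + increment β γ k x := by
  rw [increment, hγ.partialSum_add_one, hβ.partialSum_add_one]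
  ring

theorem IsNormalSeries.aestronglyMeasurable_increment {β γ : ℤ → 𝔼 → ℂ} {B G : ℤ → ℝ}
    (hβ : IsNormalSeries β B) (hγ : IsNormalSeries γ G) (k : ℤ) :
    AEStronglyMeasurable (increment β γ k) :=
  ((hβ.aestronglyMeasurable_partialSum _).mul (hγ.aestronglyMeasurable k)).add
    ((hβ.aestronglyMeasurable k).mul (hγ.aestronglyMeasurable_partialSum _))

theorem IsNormalSeries.integrable_mul_partialSum {β γ : ℤ → 𝔼 → ℂ} {B G : ℤ → ℝ}
    (hβ : IsNormalSeries β B) (hγ : IsNormalSeries γ G) (k : ℤ) {u : 𝔼 → ℂ} (hu : Integrable u) :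
    Integrable fun x => u x * (partialSum β k x * partialSum γ k x) := by
  refine hu.mul_bdd (c := (∑' i, B i) * ∑' i, G i)
    ((hβ.aestronglyMeasurable_partialSum k).mul (hγ.aestronglyMeasurable_partialSum k))
    (ae_of_all _ fun x => ?_)
  rw [norm_mul]
  exact mul_le_mul (hβ.norm_partialSum_le k x) (hγ.norm_partialSum_le k x) (norm_nonneg _)
    ((norm_nonneg _).trans (hβ.norm_partialSum_le k x))

/-- The block `Δ̇_j(ab)` only involves the increments of index `k ≥ j - 3`. -/
theorem lpNorm_block_product_le {χ : 𝔼 → ℝ} (hχ : IsCutoff χ) {a b c : 𝓢'(𝔼, ℂ)}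
    (ha : MemSh χ a) (hb : MemSh χ b) {β γ : ℤ → 𝔼 → ℂ} {B G : ℤ → ℝ}
    (hβ : IsNormalSeries β B) (hγ : IsNormalSeries γ G)
    (hβa : ∀ i, IsLpFunction ⊤ (block χ i a) (β i))
    (hγb : ∀ i, IsLpFunction ⊤ (block χ i b) (γ i)) (hc : IsProduct a b c) (j : ℤ) :
    lpNorm 2 (block χ j c) ≤ ∑' n : ℕ, eLpNorm (increment β γ (j - 3 + n)) 2 volume := by
  set S := ∑' n : ℕ, eLpNorm (increment β γ (j - 3 + n)) 2 volume
  rcases eq_or_ne S ⊤ with hSt | hSt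
  · rw [hSt]
    exact le_top
  rw [← ENNReal.coe_toNNReal hSt]
  refine lpNorm_two_le fun θ => ?_
  set ψ := testBlock χ j θ
  obtain ⟨f, g, hf, hg, hfg⟩ := hc
  have hcθ : block χ j c θ = ∫ x, ψ x * (fullSum β x * fullSum γ x) := by
    rw [block_apply, hfg.2]
    refine integral_congr_ae ?_
    filter_upwards [hf.ae_eq le_top le_top (isLpFunction_fullSum hχ ha hβ hβa),
      hg.ae_eq le_top le_top (isLpFunction_fullSum hχ hb hγ hγb)] with x hx hx'
    rw [hx, hx']
  -- The pairings `I k` vanish at `k = j - 3`, converge to the pairing with `ab`, and change at each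
  -- step by at most the `L²` norm of the increment times that of `θ`.
  set I : ℤ → ℂ := fun k => ∫ x, ψ x * (partialSum β k x * partialSum γ k x) with hI
  have hI0 : I (j - 3) = 0 := by
    have h := integral_testBlock_mul_lowCut hχ (isLpFunction_lowCut hχ ha hβ hβa (j - 3))
      (isLpFunction_lowCut hχ hb hγ hγb (j - 3)) θ
    rwa [sub_add_cancel] at h
  have hstep : ∀ k, ‖I (k + 1)‖ₑ
      ≤ ‖I k‖ₑ + eLpNorm (increment β γ k) 2 volume * eLpNorm θ 2 volume := fun k => by
    have h1 : I (k + 1) = I k + ∫ x, ψ x * increment β γ k x := by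
      have hint : Integrable fun x => ψ x * increment β γ k x := by
        refine ((hβ.integrable_mul_partialSum hγ (k + 1) ψ.integrable).sub
          (hβ.integrable_mul_partialSum hγ k ψ.integrable)).congr (ae_of_all _ fun x => ?_)
        simp only [Pi.sub_apply]
        rw [hβ.partialSum_mul_add_one hγ]
        ring
      rw [hI, ← integral_add (hβ.integrable_mul_partialSum hγ k ψ.integrable) hint]
      simp_rw [hβ.partialSum_mul_add_one hγ, mul_add]
    rw [h1]
    refine (enorm_add_le _ _).trans (add_le_add le_rfl ?_)
    refine (enorm_integral_mul_le_two ψ.continuous.aestronglyMeasurable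
      (hβ.aestronglyMeasurable_increment hγ k)).trans ?_
    rw [mul_comm]
    exact mul_le_mul_right (eLpNorm_testBlock_le hχ j θ) _
  have hbound : ∀ N : ℕ, ‖I (j - 3 + N)‖ₑ ≤ (∑ n ∈ Finset.range N,
      eLpNorm (increment β γ (j - 3 + n)) 2 volume) * eLpNorm θ 2 volume := fun N => by
    induction N with
    | zero => simp [hI0]
    | succ N ih =>
      rw [Finset.sum_range_succ, add_mul]
      have := hstep (j - 3 + N)
      rw [add_assoc] at this
      exact_mod_cast this.trans (add_le_add ih le_rfl)
  have hlim : Tendsto (fun N : ℕ => ‖I (j - 3 + N)‖ₑ) atTop (𝓝 ‖block χ j c θ‖ₑ) := by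
    rw [hcθ]
    refine (continuous_enorm.tendsto _).comp ?_
    exact (hβ.tendsto_integral_partialSum_mul hγ ψ.integrable).comp
      (tendsto_atTop_add_const_left _ _ tendsto_natCast_atTop_atTop)
  have hfin : ‖block χ j c θ‖ₑ ≤ S * eLpNorm θ 2 volume :=
    le_of_tendsto' hlim fun N => (hbound N).trans
      (mul_le_mul_left (ENNReal.sum_le_tsum (Finset.range N)) _)
  have hreal := ENNReal.toReal_mono
    (ENNReal.mul_ne_top hSt (θ.eLpNorm_lt_top 2 volume).ne) hfin
  rw [ENNReal.toReal_mul, toReal_enorm] at hreal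
  rw [SchwartzMap.norm_toLp]
  exact hreal

/-! ### Lebesgue norms of the increments -/

/-- Interpolation with `L^∞`: `|f|^r ≤ |f|^q M^{r-q}`. For `r = ∞` the exponent `q / r` is zero. -/
theorem eLpNorm_le_rpow_mul_rpow {f : 𝔼 → ℂ} (hf : AEStronglyMeasurable f) {q r M : ℝ≥0∞}
    (hq0 : q ≠ 0) (hq : q ≠ ⊤) (hqr : q ≤ r) (hM : ∀ x, ‖f x‖ₑ ≤ M) :
    eLpNorm f r volume ≤ eLpNorm f q volume ^ (q / r).toReal * M ^ (1 - (q / r).toReal) := by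
  rcases eq_or_ne r ⊤ with rfl | hr
  · simpa using eLpNormEssSup_le_of_ae_enorm_bound (ae_of_all volume hM)
  have hr0 : r ≠ 0 := (hq0.bot_lt.trans_le hqr).ne'
  have hqp : 0 < q.toReal := ENNReal.toReal_pos hq0 hq
  have hrp : 0 < r.toReal := ENNReal.toReal_pos hr0 hr
  have hle : q.toReal ≤ r.toReal := ENNReal.toReal_mono hr hqr
  rw [eLpNorm_eq_lintegral_rpow_enorm_toReal hr0 hr, eLpNorm_eq_lintegral_rpow_enorm_toReal hq0 hq,
    ← ENNReal.rpow_mul, ENNReal.toReal_div]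
  have h1 : ∫⁻ x, ‖f x‖ₑ ^ r.toReal
      ≤ (∫⁻ x, ‖f x‖ₑ ^ q.toReal) * M ^ (r.toReal - q.toReal) := by
    rw [← lintegral_mul_const'' _ (hf.enorm.pow_const _)]
    refine lintegral_mono fun x => ?_
    calc ‖f x‖ₑ ^ r.toReal = ‖f x‖ₑ ^ (q.toReal + (r.toReal - q.toReal)) := by
          rw [add_sub_cancel]
      _ = ‖f x‖ₑ ^ q.toReal * ‖f x‖ₑ ^ (r.toReal - q.toReal) :=
          ENNReal.rpow_add_of_nonneg _ _ hqp.le (sub_nonneg.2 hle)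
      _ ≤ _ := mul_le_mul_right (ENNReal.rpow_le_rpow (hM x) (sub_nonneg.2 hle)) _
  refine (ENNReal.rpow_le_rpow h1 (by positivity)).trans (le_of_eq ?_)
  rw [ENNReal.mul_rpow_of_nonneg _ _ (by positivity), ← ENNReal.rpow_mul]
  congr 2 <;> field_simp

/-- Bernstein's inequality `L^q → L^r`, `q ≤ r`, from the one for `r = ∞`. -/
theorem eLpNorm_block_le {χ : 𝔼 → ℝ} {q r : ℝ≥0∞} (hq : 1 ≤ q) (hqt : q ≠ ⊤) (hqr : q ≤ r)
    {z : 𝓢'(𝔼, ℂ)} {i : ℤ} {h : 𝔼 → ℂ} (hh : IsLpFunction ⊤ (block χ i z) h) {C : ℝ≥0}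
    (hC : ∀ x, ‖h x‖ₑ ≤ C * blockNorm χ (d / q.toReal) q z i) :
    eLpNorm h r volume ≤ (C ^ (1 - (q / r).toReal) : ℝ≥0)
      * blockNorm χ (d / q.toReal - ((d : ℝ≥0∞) / r).toReal) q z i := by
  have hq0 : q ≠ 0 := (zero_lt_one.trans_le hq).ne'
  have hqp : 0 < q.toReal := ENNReal.toReal_pos hq0 hqt
  have hle := eLpNorm_le_lpNorm (r := q) le_top hq hh
  have ht0 : 0 ≤ (q / r).toReal := ENNReal.toReal_nonneg
  have ht1 : (q / r).toReal ≤ 1 := by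
    refine ENNReal.toReal_le_of_le_ofReal zero_le_one ?_
    rw [ENNReal.ofReal_one]
    exact ENNReal.div_le_of_le_mul (by rwa [one_mul])
  refine (eLpNorm_le_rpow_mul_rpow hh.1.1 hq0 hqt hqr hC).trans ?_
  set t := (q / r).toReal with ht
  have hexp : d / q.toReal - ((d : ℝ≥0∞) / r).toReal = d / q.toReal * (1 - t) := by
    rw [ht, ENNReal.toReal_div, ENNReal.toReal_div, ENNReal.toReal_natCast]
    field_simp
  rw [blockNorm, blockNorm, hexp, ENNReal.mul_rpow_of_nonneg _ _ (sub_nonneg.2 ht1),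
    ENNReal.mul_rpow_of_nonneg _ _ (sub_nonneg.2 ht1),
    ENNReal.ofReal_rpow_of_nonneg (by positivity) (sub_nonneg.2 ht1), ← Real.rpow_mul two_pos.le,
    ENNReal.coe_rpow_of_nonneg _ (sub_nonneg.2 ht1), ← mul_assoc (i : ℝ)]
  have hL : lpNorm q (block χ i z) ^ t * lpNorm q (block χ i z) ^ (1 - t)
      = lpNorm q (block χ i z) := by
    rw [← ENNReal.rpow_add_of_nonneg _ _ ht0 (sub_nonneg.2 ht1), add_sub_cancel, ENNReal.rpow_one]
  refine (mul_le_mul_left (ENNReal.rpow_le_rpow hle ht0) _).trans (le_of_eq ?_)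
  nth_rewrite 3 [← hL]
  ring

theorem eLpNorm_mul_le {f g : 𝔼 → ℂ} (hf : AEStronglyMeasurable f) (hg : AEStronglyMeasurable g)
    (r q t : ℝ≥0∞) [ENNReal.HolderTriple r q t] :
    eLpNorm (fun x => f x * g x) t volume ≤ eLpNorm f r volume * eLpNorm g q volume := by
  have h := eLpNorm_smul_le_mul_eLpNorm (p := r) (q := q) (r := t) hg hf
  exact h

theorem eLpNorm_increment_le {β γ : ℤ → 𝔼 → ℂ} {B G : ℤ → ℝ} (hβ : IsNormalSeries β B)
    (hγ : IsNormalSeries γ G) {r q : ℝ≥0∞} (hr : 1 ≤ r) [ENNReal.HolderTriple r q 2] (k : ℤ) :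
    eLpNorm (increment β γ k) 2 volume ≤
      (∑' i : Set.Iio (k + 1), eLpNorm (β i) r volume) * eLpNorm (γ k) q volume
      + (∑' i : Set.Iio (k + 1), eLpNorm (γ i) r volume) * eLpNorm (β k) q volume := by
  have hP := hβ.aestronglyMeasurable_partialSum (k + 1)
  have hQ := hγ.aestronglyMeasurable_partialSum k
  refine (eLpNorm_add_le (hP.mul (hγ.aestronglyMeasurable k))
    ((hβ.aestronglyMeasurable k).mul hQ) one_le_two).trans (add_le_add ?_ ?_)
  · exact (eLpNorm_mul_le hP (hγ.aestronglyMeasurable k) r q 2).trans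
      (mul_le_mul_left (hβ.eLpNorm_partialSum_le hr _) _)
  · have h : eLpNorm (fun x => β k x * partialSum γ k x) 2 volume
        = eLpNorm (fun x => partialSum γ k x * β k x) 2 volume := by simp_rw [mul_comm]
    refine le_trans (le_of_eq h) ((eLpNorm_mul_le hQ (hβ.aestronglyMeasurable k) r q 2).trans
      (mul_le_mul_left ((hγ.eLpNorm_partialSum_le hr _).trans ?_) _))
    -- The sum over `i < k` is enlarged to `i < k + 1` to make the bound symmetric in the two
    -- series.
    exact ENNReal.tsum_mono_subtype (fun i : ℤ => eLpNorm (γ i) r volume)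
      (Set.Iio_subset_Iio (by omega))

/-! ### Summation over dyadic indices -/

theorem tsum_ofReal_rpow_lt_top {s : ℝ} (hs : 0 < s) :
    ∑' n : ℕ, ENNReal.ofReal ((2 : ℝ) ^ ((3 - (n : ℝ)) * s)) < ⊤ := by
  have h : ∀ n : ℕ, ENNReal.ofReal ((2 : ℝ) ^ ((3 - (n : ℝ)) * s))
      = ENNReal.ofReal ((2 : ℝ) ^ (3 * s)) * ENNReal.ofReal ((2 : ℝ) ^ (-s)) ^ n := fun n => by
    rw [← ENNReal.ofReal_pow (by positivity), ← ENNReal.ofReal_mul (by positivity),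
      ← Real.rpow_mul_natCast two_pos.le, ← Real.rpow_add two_pos]
    congr 2
    ring
  simp_rw [h]
  rw [ENNReal.tsum_mul_left, ENNReal.tsum_geometric]
  refine ENNReal.mul_lt_top ENNReal.ofReal_lt_top ?_
  rw [ENNReal.inv_lt_top, tsub_pos_iff_lt, ENNReal.ofReal_lt_one]
  exact Real.rpow_lt_one_of_one_lt_of_neg one_lt_two (neg_neg_of_pos hs)

/-- Discrete Young inequality: with `k = j - 3 + n` the weight splits as `2^{js} = 2^{(3-n)s}
2^{ks}`. -/
theorem tsum_Ici_shift_le (J : ℤ) (s : ℝ) (X : ℤ → ℝ≥0∞) :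
    ∑' j : Set.Ici J, ENNReal.ofReal ((2 : ℝ) ^ ((j : ℝ) * s)) * ∑' n : ℕ, X (j - 3 + n)
      ≤ (∑' n : ℕ, ENNReal.ofReal ((2 : ℝ) ^ ((3 - (n : ℝ)) * s)))
        * ∑' k : Set.Ici (J - 3), ENNReal.ofReal ((2 : ℝ) ^ ((k : ℝ) * s)) * X k := by
  simp_rw [← ENNReal.tsum_mul_left (α := ℕ)]
  rw [ENNReal.tsum_comm, ← ENNReal.tsum_mul_right]
  refine ENNReal.tsum_le_tsum fun n => ?_
  have hsplit : ∀ j : Set.Ici J, ENNReal.ofReal ((2 : ℝ) ^ ((j : ℝ) * s)) * X (j - 3 + n)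
      = ENNReal.ofReal ((2 : ℝ) ^ ((3 - (n : ℝ)) * s)) *
        (ENNReal.ofReal ((2 : ℝ) ^ ((((j : ℤ) - 3 + n : ℤ) : ℝ) * s)) * X (j - 3 + n)) :=
    fun j => by
      rw [← mul_assoc, ← ENNReal.ofReal_mul (by positivity), ← Real.rpow_add two_pos]
      congr 3
      push_cast
      ring
  simp_rw [hsplit]
  rw [ENNReal.tsum_mul_left]
  refine mul_le_mul_right ?_ _
  let e : Set.Ici J → Set.Ici (J - 3) := fun j => ⟨(j : ℤ) - 3 + n, by
    have := Set.mem_Ici.1 j.2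
    rw [Set.mem_Ici]
    omega⟩
  have he : Function.Injective e := fun j j' h => by
    have h' : (j : ℤ) - 3 + n = (j' : ℤ) - 3 + n := congrArg Subtype.val h
    exact Subtype.ext (by omega)
  exact ENNReal.tsum_comp_le_tsum_of_injective he
    (fun k : Set.Ici (J - 3) => ENNReal.ofReal ((2 : ℝ) ^ ((k : ℝ) * s)) * X k)

theorem tsum_Ici_le_add (J : ℤ) {Y U V : ℤ → ℝ≥0∞} (hU : ∀ k, J ≤ k → Y k ≤ U k)
    (hV : ∀ k, J - 3 ≤ k → k < J → Y k ≤ V k) :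
    ∑' k : Set.Ici (J - 3), Y k ≤ (∑' k : Set.Ici J, U k) + ∑' k : Set.Iic (J + 1), V k := by
  rw [tsum_subtype (Set.Ici (J - 3)) Y, tsum_subtype (Set.Ici J) U,
    tsum_subtype (Set.Iic (J + 1)) V, ← ENNReal.tsum_add]
  refine ENNReal.tsum_le_tsum fun k => ?_
  by_cases h3 : J - 3 ≤ k
  · rw [Set.indicator_of_mem (Set.mem_Ici.2 h3)]
    rcases le_or_gt J k with h | h
    · rw [Set.indicator_of_mem (Set.mem_Ici.2 h)]
      exact (hU k h).trans le_self_add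
    · rw [Set.indicator_of_mem (s := Set.Iic (J + 1)) (Set.mem_Iic.2 (by omega))]
      exact (hV k h3 h).trans le_add_self
  · rw [Set.indicator_of_notMem (by simpa using h3)]
    exact zero_le

/-! ### The exponent `p*` -/

theorem inv_pStar {p : ℝ} (hp : 2 ≤ p) : (pStar p)⁻¹ = ENNReal.ofReal ((p - 2) / (2 * p)) := by
  rw [pStar, ENNReal.inv_div (Or.inl ENNReal.ofReal_ne_top)
    (Or.inr (by simpa using by linarith)), ENNReal.ofReal_div_of_pos (by linarith)]

theorem holderTriple_pStar {p : ℝ} (hp : 2 ≤ p) :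
    ENNReal.HolderTriple (pStar p) (ENNReal.ofReal p) 2 := by
  constructor
  rw [inv_pStar hp, ← ENNReal.ofReal_inv_of_pos (by linarith),
    ← ENNReal.ofReal_add (div_nonneg (by linarith) (by linarith)) (by positivity)]
  have h : (p - 2) / (2 * p) + p⁻¹ = 2⁻¹ := by
    have : p ≠ 0 := by linarith
    field_simp
    ring
  rw [h, ENNReal.ofReal_inv_of_pos two_pos, ENNReal.ofReal_ofNat]

/-- This is where `p ≤ 4` enters: `1/p* = 1/2 - 1/p ≤ 1/p`. Bernstein can then pass from `L^p` to
`L^{p*}`. -/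
theorem le_pStar {p : ℝ} (hp : 2 ≤ p) (hp4 : p ≤ 4) : ENNReal.ofReal p ≤ pStar p := by
  rw [← ENNReal.inv_le_inv, inv_pStar hp, ← ENNReal.ofReal_inv_of_pos (by linarith)]
  refine ENNReal.ofReal_le_ofReal ?_
  rw [div_le_iff₀ (by linarith)]
  have : p⁻¹ * (2 * p) = 2 := by
    have : p ≠ 0 := by linarith
    field_simp
  linarith

/-! ### Assembly of the high frequency estimate. -/

theorem tsum_Iio_le_mul {X N : ℤ → ℝ≥0∞} {C : ℝ≥0∞} (h : ∀ i, X i ≤ C * N i) {k : ℤ} {S : Set ℤ}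
    (hS : Set.Iio (k + 1) ⊆ S) : ∑' i : Set.Iio (k + 1), X i ≤ C * ∑' i : S, N i := by
  rw [← ENNReal.tsum_mul_left]
  exact (ENNReal.tsum_le_tsum fun i : Set.Iio (k + 1) => h i).trans
    (ENNReal.tsum_mono_subtype (fun i => C * N i) hS)

theorem ofReal_rpow_le_mul {J k : ℤ} (hk : J - 3 ≤ k) {s σ : ℝ} (hσ : s ≤ σ) :
    ENNReal.ofReal ((2 : ℝ) ^ ((k : ℝ) * s)) ≤
      ENNReal.ofReal ((2 : ℝ) ^ (((J : ℝ) - 3) * (s - σ)))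
        * ENNReal.ofReal ((2 : ℝ) ^ ((k : ℝ) * σ)) := by
  rw [← ENNReal.ofReal_mul (by positivity), ← Real.rpow_add two_pos]
  refine ENNReal.ofReal_le_ofReal (Real.rpow_le_rpow_of_exponent_le one_le_two ?_)
  have hk' : (J : ℝ) - 3 ≤ k := by exact_mod_cast hk
  nlinarith [mul_nonneg (sub_nonneg.2 hk') (sub_nonneg.2 hσ)]

/-- The product estimate for high frequencies. -/
theorem exists_besovNormHigh_product_le {χ : 𝔼 → ℝ} (hχ : IsCutoff χ) (J : ℤ) {q r : ℝ≥0∞}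
    (hq : 1 < q) (hqt : q ≠ ⊤) (hqr : q ≤ r) [ENNReal.HolderTriple r q 2] {s σ : ℝ} (hs : 0 < s)
    (hσ : s ≤ σ) :
    ∃ C : ℝ≥0, ∀ a b : 𝓢'(𝔼, ℂ), MemBesov χ (d / q.toReal) q a → MemBesov χ (d / q.toReal) q b →
      (∃ c, IsProduct a b c) ∧
      ∀ c, IsProduct a b c → besovNormHigh χ J s 2 c ≤
        C * (besovNorm χ (d / q.toReal) q a * besovNormHigh χ J s 2 b
          + besovNorm χ (d / q.toReal) q b * besovNormHigh χ J s 2 a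
          + besovNormLow χ J (d / q.toReal - ((d : ℝ≥0∞) / r).toReal) q a
              * besovNormLow χ J σ q b
          + besovNormLow χ J (d / q.toReal - ((d : ℝ≥0∞) / r).toReal) q b
              * besovNormLow χ J σ q a) := by
  obtain ⟨C, hC⟩ := exists_isNormalSeries hχ hq
  set C' : ℝ≥0 := C ^ (1 - (q / r).toReal)
  set D := ENNReal.ofReal ((2 : ℝ) ^ (((J : ℝ) - 3) * (s - σ)))
  set Γ := ∑' n : ℕ, ENNReal.ofReal ((2 : ℝ) ^ ((3 - (n : ℝ)) * s))
  -- `Γ` sums the weights over `j`, `C` is the Bernstein constant into `L^∞` and `C'` the one into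
  -- `L^r`; `D` pays for replacing `s` by `σ` when `k ≥ J - 3`.
  set K : ℝ≥0∞ := Γ * (C + C' * D) with hK
  have hKt : K ≠ ⊤ := ENNReal.mul_ne_top (tsum_ofReal_rpow_lt_top hs).ne
    (ENNReal.add_ne_top.2 ⟨ENNReal.coe_ne_top,
      ENNReal.mul_ne_top ENNReal.coe_ne_top ENNReal.ofReal_ne_top⟩)
  refine ⟨K.toNNReal, fun a b ha hb => ?_⟩
  rw [ENNReal.coe_toNNReal hKt]
  obtain ⟨β, B, hβ, hβa, hβC⟩ := hC a ha
  obtain ⟨γ, G, hγ, hγb, hγC⟩ := hC b hb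
  have hfa := isLpFunction_fullSum hχ ha.1 hβ hβa
  have hgb := isLpFunction_fullSum hχ hb.1 hγ hγb
  refine ⟨?_, fun c hc => ?_⟩
  · obtain ⟨c, hc⟩ := exists_isLpFunction (q := ⊤) le_top
      (hgb.1.mul (p := ⊤) (q := ⊤) (r := ⊤) hfa.1)
    exact ⟨c, _, _, hfa, hgb, hc⟩
  set A := besovNorm χ (d / q.toReal) q a
  set A' := besovNorm χ (d / q.toReal) q b
  set L := besovNormLow χ J (d / q.toReal - ((d : ℝ≥0∞) / r).toReal) q a
  set L' := besovNormLow χ J (d / q.toReal - ((d : ℝ≥0∞) / r).toReal) q b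
  have htop : ∀ {z : 𝓢'(𝔼, ℂ)} {η : ℤ → 𝔼 → ℂ},
      (∀ i x, ‖η i x‖ₑ ≤ C * blockNorm χ (d / q.toReal) q z i) → ∀ k : ℤ,
      ∑' i : Set.Iio (k + 1), eLpNorm (η i) ⊤ volume
        ≤ C * besovNorm χ (d / q.toReal) q z := fun {z η} h k => by
    have h1 := tsum_Iio_le_mul (X := fun i => eLpNorm (η i) ⊤ volume) (k := k)
      (S := Set.univ) (fun i => by
        rw [eLpNorm_exponent_top]
        exact eLpNormEssSup_le_of_ae_enorm_bound (ae_of_all volume (h i))) (Set.subset_univ _)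
    rwa [tsum_univ (fun i => blockNorm χ (d / q.toReal) q z i)] at h1
  have hlow : ∀ {z : 𝓢'(𝔼, ℂ)} {η : ℤ → 𝔼 → ℂ},
      (∀ i, IsLpFunction ⊤ (block χ i z) (η i)) →
      (∀ i x, ‖η i x‖ₑ ≤ C * blockNorm χ (d / q.toReal) q z i) → ∀ k : ℤ, k < J →
      ∑' i : Set.Iio (k + 1), eLpNorm (η i) r volume
        ≤ C' * besovNormLow χ J (d / q.toReal - ((d : ℝ≥0∞) / r).toReal) q z :=
    fun {z η} hη h k hk => by
      refine tsum_Iio_le_mul (X := fun i => eLpNorm (η i) r volume)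
        (fun i => eLpNorm_block_le hq.le hqt hqr (hη i) (h i)) fun i hi => ?_
      rw [Set.mem_Iio] at hi
      rw [Set.mem_Iic]
      omega
  have hhigh : ∀ k, J ≤ k →
      ENNReal.ofReal ((2 : ℝ) ^ ((k : ℝ) * s)) * eLpNorm (increment β γ k) 2 volume
        ≤ C * (A * blockNorm χ s 2 b k + A' * blockNorm χ s 2 a k) := fun k _ => by
    -- If a block is not an `L²` function, its `lpNorm` is `∞` and the comparison still holds.
    have h1 := eLpNorm_increment_le hβ hγ (r := ⊤) (q := 2) le_top k
    have h2 : eLpNorm (increment β γ k) 2 volume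
        ≤ C * A * lpNorm 2 (block χ k b) + C * A' * lpNorm 2 (block χ k a) :=
      h1.trans (add_le_add
        (mul_le_mul' (htop hβC k) (eLpNorm_le_lpNorm le_top one_le_two (hγb k)))
        (mul_le_mul' (htop hγC k) (eLpNorm_le_lpNorm le_top one_le_two (hβa k))))
    refine (mul_le_mul_right h2 _).trans (le_of_eq ?_)
    rw [blockNorm, blockNorm]
    ring
  have hlowk : ∀ k, J - 3 ≤ k → k < J →
      ENNReal.ofReal ((2 : ℝ) ^ ((k : ℝ) * s)) * eLpNorm (increment β γ k) 2 volume
        ≤ C' * D * (L * blockNorm χ σ q b k + L' * blockNorm χ σ q a k) := fun k hk3 hk => by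
    -- The factors with `i ≤ k < J` and the block `k` itself are all counted by the low frequency
    -- norms.
    have h1 := eLpNorm_increment_le hβ hγ (r := r) (q := q) (hq.le.trans hqr) k
    have h2 : eLpNorm (increment β γ k) 2 volume
        ≤ C' * L * lpNorm q (block χ k b) + C' * L' * lpNorm q (block χ k a) :=
      h1.trans (add_le_add
        (mul_le_mul' (hlow hβa hβC k hk) (eLpNorm_le_lpNorm le_top hq.le (hγb k)))
        (mul_le_mul' (hlow hγb hγC k hk) (eLpNorm_le_lpNorm le_top hq.le (hβa k))))
    refine (mul_le_mul' (ofReal_rpow_le_mul hk3 hσ) h2).trans (le_of_eq ?_)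
    rw [blockNorm, blockNorm]
    ring
  calc besovNormHigh χ J s 2 c
      ≤ ∑' j : Set.Ici J, ENNReal.ofReal ((2 : ℝ) ^ ((j : ℝ) * s)) *
          ∑' n : ℕ, eLpNorm (increment β γ (j - 3 + n)) 2 volume :=
        ENNReal.tsum_le_tsum fun j => mul_le_mul_right
          (lpNorm_block_product_le hχ ha.1 hb.1 hβ hγ hβa hγb hc j) _
    _ ≤ Γ * ∑' k : Set.Ici (J - 3), ENNReal.ofReal ((2 : ℝ) ^ ((k : ℝ) * s)) *
          eLpNorm (increment β γ k) 2 volume :=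
        tsum_Ici_shift_le J s fun k => eLpNorm (increment β γ k) 2 volume
    _ ≤ Γ * (C * (A * besovNormHigh χ J s 2 b + A' * besovNormHigh χ J s 2 a)
          + C' * D * (L * besovNormLow χ J σ q b + L' * besovNormLow χ J σ q a)) := by
        refine mul_le_mul_right ((tsum_Ici_le_add J hhigh hlowk).trans (le_of_eq ?_)) _
        simp only [ENNReal.tsum_mul_left, ENNReal.tsum_add, besovNormHigh, besovNormLow]
    _ ≤ K * (A * besovNormHigh χ J s 2 b + A' * besovNormHigh χ J s 2 a
          + L * besovNormLow χ J σ q b + L' * besovNormLow χ J σ q a) := by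
        rw [hK, add_assoc (A * _ + _), mul_assoc Γ]
        generalize A * besovNormHigh χ J s 2 b + A' * besovNormHigh χ J s 2 a = u
        generalize L * besovNormLow χ J σ q b + L' * besovNormLow χ J σ q a = v
        refine mul_le_mul_right ?_ Γ
        rw [add_mul, mul_add, mul_add]
        exact add_le_add le_self_add le_add_self

end HybridBesov

end

theorem mainTheorem5 (d : ℕ) (hd : 1 ≤ d) (χ : EuclideanSpace ℝ (Fin d) → ℝ)
    (hχ : HybridBesov.IsCutoff χ) (J : ℤ) (p : ℝ) (hp2 : 2 ≤ p) (hp4 : p ≤ 4)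
    (s σ : ℝ) (hs : 0 < s) (hσ : s ≤ σ) :
    ∃ C : ℝ≥0, ∀ a b : 𝓢'(EuclideanSpace ℝ (Fin d), ℂ),
      HybridBesov.MemBesov χ (d / p) (ENNReal.ofReal p) a →
      HybridBesov.MemBesov χ (d / p) (ENNReal.ofReal p) b →
      (∃ c, HybridBesov.IsProduct a b c) ∧
      ∀ c, HybridBesov.IsProduct a b c →
        HybridBesov.besovNormHigh χ J s 2 c ≤
          C * (HybridBesov.besovNorm χ (d / p) (ENNReal.ofReal p) a *
                HybridBesov.besovNormHigh χ J s 2 b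
            + HybridBesov.besovNorm χ (d / p) (ENNReal.ofReal p) b *
                HybridBesov.besovNormHigh χ J s 2 a
            + HybridBesov.besovNormLow χ J (d / p - ((d : ℝ≥0∞) / HybridBesov.pStar p).toReal)
                  (ENNReal.ofReal p) a *
                HybridBesov.besovNormLow χ J σ (ENNReal.ofReal p) b
            + HybridBesov.besovNormLow χ J (d / p - ((d : ℝ≥0∞) / HybridBesov.pStar p).toReal)
                  (ENNReal.ofReal p) b *
                HybridBesov.besovNormLow χ J σ (ENNReal.ofReal p) a) := by
  have := HybridBesov.holderTriple_pStar hp2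
  have h := HybridBesov.exists_besovNormHigh_product_le hχ J (q := ENNReal.ofReal p)
    (r := HybridBesov.pStar p) (ENNReal.one_lt_ofReal.2 (by linarith)) ENNReal.ofReal_ne_top
    (HybridBesov.le_pStar hp2 hp4) hs hσ
  rwa [ENNReal.toReal_ofReal (by linarith)] at h
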